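/- Let $(\mathsf X,\mathcal X)$ and $(\mathsf Y,\mathcal Y)$ be measurable spaces, $Q$ a Markov kernel on $\mathsf X$, and $G$ a Markov kernel from $\mathsf X$ to $\mathsf Y$ with $G(x,\mathrm dy)=g(x,y)\,\nu(\mathrm dy)$ for a $\sigma$-finite measure $\nu$ and a measurable $g\ge 0$ on $\mathsf X\times\mathsf Y$. Let $(Y_k)_{k\in\mathbb N}$ be a strictly stationary $\mathsf Y$-valued sequence on a probability space $(\Omega,\mathcal A,\mathbb P)$ (not assumed to come from the model $(Q,G)$). For $y=(y_k)_{k\in\mathbb N}$ and $k\le m$ let $L\langle y_{k:m}\rangle(x_k,A)=\int\cdots\int \mathbf 1_A(x_{m+1})\prod_{\ell=k}^m g(x_\ell,y_\ell)\,Q(x_\ell,\mathrm dx_{\ell+1})$, and $L\langle y_{k:m}\rangle(x,\cdot)=\delta_x$ for $k>m$. For a probability measure $\chi$ on $\mathsf X$ let $\phi_\chi\langle y_{0:n-1}\rangle(A)=\chi L\langle y_{0:n-1}\rangle\mathbf 1_A/\chi L\langle y_{0:n-1}\rangle\mathbf 1_{\mathsf X}$ be the predictor, and for bounded measurable $h:\mathsf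 X\to\mathbb R$ let $\sigma_\chi\langle y_{0:n-1}\rangle(h)\ge 0$ be given by $$\sigma_\chi^2\langle y_{0:n-1}\rangle(h)=\sum_{k=0}^n \phi_\chi\langle y_{0:k-1}\rangle\left(\frac{L\langle y_{k:n-1}\rangle h-\phi_\chi\langle y_{0:n-1}\rangle h\cdot L\langle y_{k:n-1}\rangle\mathbf 1_{\mathsf X}}{\phi_\chi\langle y_{0:k-1}\rangle L\langle y_{k:n-1}\rangle\mathbf 1_{\mathsf X}}\right)^2 .$$ For each $N\ge 1$ let $(\xi_n^{N,i})_{n\in\mathbb N,\,1\le i\le N}$ be the particles of a bootstrap particle filter run on $(Y_k)$: given $(Y_k)_{k\in\mathbb N}$, the $\xi_0^{N,i}$ are i.i.d. with law $\chi$; given $(Y_k)_{k\in\mathbb N}$ and all particles up to time $n$, the $\xi_{n+1}^{N,i}$, $1\le i\le N$, are i.i.d. with law $\sum_{j=1}^N \frac{g(\xi_n^{N,j},Y_n)}{\sum_{\ell=1}^N g(\xi_n^{N,\ell},Y_n)}\,Q(\xi_n^{N,j},\cdot)$. Write $\phi^N_\chi\langle Y_{0:n-1}\rangle h=\frac1N\sum_{i=1}^N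 h(\xi_n^{N,i})$. Theorem. Assume (A2): $g(x,y)>0$ for all $(x,y)\in\mathsf X\times\mathsf Y$, and $\mathbb E\big[\ln^+\sup_{x\in\mathsf X} g(x,Y_0)\big]<\infty$. Then for every bounded measurable $h:\mathsf X\to\mathbb R$, every $p>0$, every probability measure $\chi$ on $\mathsf X$ and every $n\in\mathbb N$, $\mathbb P$-almost surely, $$\lim_{N\to\infty}\sqrt N\;\mathbb E\Big[\big|\phi_\chi^N\langle Y_{0:n-1}\rangle h-\phi_\chi\langle Y_{0:n-1}\rangle h\big|^p\,\Big|\,Y_{0:n-1}\Big]^{1/p}=\sqrt2\,\sigma_\chi\langle Y_{0:n-1}\rangle(h)\left(\frac{\Gamma((p+1)/2)}{\sqrt{\pi}}\right)^{1/p},$$ where $\Gamma$ is the gamma function. The right-hand side equals $\big(\int_{\mathbb R}|\sigma_\chi\langle Y_{0:n-1}\rangle(h)\,z|^p\,\gamma(\mathrm dz)\big)^{1/p}$ with $\gamma$ the standard normal law, that is, the $L^p$ norm of the centred normal distribution with standard deviation $\sigma_\chi\langle Y_{0:n-1}\rangle(h)$. -/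

import Mathlib

open MeasureTheory ProbabilityTheory Filter Topology
open scoped ENNReal

noncomputable section

/-- A hidden Markov model with state space `X` and observation space `Y`: a Markov transition
kernel `Q` on `X` and a Markov observation kernel `G` from `X` to `Y`, where `G` has the
transition density `g` with respect to a `σ`-finite measure `ν` on `Y`. -/
structure HMM (X Y : Type*) [MeasurableSpace X] [MeasurableSpace Y] where
  Q : Kernel X X
  G : Kernel X Y
  ν : Measure Y
  g : X → Y → ℝ
  markovQ : IsMarkovKernel Q
  markovG : IsMarkovKernel G
  sigmaFinite_ν : SigmaFinite ν
  measurable_g : Measurable (Function.uncurry g)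
  g_nonneg : ∀ x y, 0 ≤ g x y
  G_eq : ∀ x, G x = ν.withDensity (fun y => ENNReal.ofReal (g x y))

attribute [instance] HMM.markovQ HMM.markovG HMM.sigmaFinite_ν

namespace HMM

variable {X Y : Type*} [MeasurableSpace X] [MeasurableSpace Y] (M : HMM X Y)

/-- The supremum norm of the local likelihood `x ↦ g x y`, with values in `[0, ∞]`. -/
def likSup (y : Y) : ℝ≥0∞ := ⨆ x, ENNReal.ofReal (M.g x y)

/-- The one-step unnormalized kernel `(x, A) ↦ g(x, y) Q(x, A)`. -/
def step (y : Y) : Kernel X X :=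
  M.Q.withDensity (fun x _ => ENNReal.ofReal (M.g x y))

/-- `M.L y k m` is the unnormalized kernel associated with the `m` observations
`y k, …, y (k + m - 1)`: starting from `x_k`, it integrates out `x_{k+1}, …, x_{k+m-1}` in
`∏_{ℓ = k}^{k+m-1} g(x_ℓ, y_ℓ) Q(x_ℓ, dx_{ℓ+1})`. It is `δ_x` when `m = 0`. -/
def L (y : ℕ → Y) (k : ℕ) : ℕ → Kernel X X
  | 0 => Kernel.id
  | m + 1 => M.step (y (k + m)) ∘ₖ L y k m

/-- The predictor of the state at time `n` given the observations `y 0, …, y (n - 1)`, for the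
initial law `χ`: the normalization of `χ L`. -/
def predictor (χ : Measure X) (y : ℕ → Y) (n : ℕ) : Measure X :=
  ((M.L y 0 n ∘ₘ χ) Set.univ)⁻¹ • (M.L y 0 n ∘ₘ χ)

/-- The asymptotic variance `σ_χ²⟨y_{0:n-1}⟩(h)` of the particle predictor. -/
def asympVar (χ : Measure X) (y : ℕ → Y) (n : ℕ) (h : X → ℝ) : ℝ :=
  ∑ k ∈ Finset.range (n + 1),
    ∫ x, ((∫ z, h z ∂(M.L y k (n - k) x)
            - (∫ z, h z ∂(M.predictor χ y n)) * ∫ _z, (1 : ℝ) ∂(M.L y k (n - k) x))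
          / ∫ x', (∫ _z, (1 : ℝ) ∂(M.L y k (n - k) x')) ∂(M.predictor χ y k)) ^ 2
      ∂(M.predictor χ y k)

/-- The asymptotic standard deviation `σ_χ⟨y_{0:n-1}⟩(h)`. -/
def asympStd (χ : Measure X) (y : ℕ → Y) (n : ℕ) (h : X → ℝ) : ℝ :=
  √(M.asympVar χ y n h)

/-- The mixture `∑ j, (ω^j / ∑ ℓ, ω^ℓ) Q(x^j, ·)` with the importance weights `ω^j = g(x^j, y)`,
from which the particles of the next generation are drawn. -/
def mixture (y : Y) {N : ℕ} (x : Fin N → X) : Measure X :=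
  ∑ j, ENNReal.ofReal (M.g (x j) y / ∑ l, M.g (x l) y) • M.Q (x j)

/-- The likelihood is positive and `E[log⁺ ‖g_{Y₀}‖_∞] < ∞`. (`EReal.toENNReal` sends negative
values to `0`, so it turns the extended logarithm into its positive part.) -/
structure LikelihoodCondition {Ω : Type*} [MeasurableSpace Ω] (P : Measure Ω)
    (Yobs : ℕ → Ω → Y) : Prop where
  g_pos : ∀ x y, 0 < M.g x y
  aemeasurable_likSup : AEMeasurable M.likSup (P.map (Yobs 0))
  integrable_log : ∫⁻ ω, (ENNReal.log (M.likSup (Yobs 0 ω))).toENNReal ∂P < ∞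

/-- `ξ n i`, `n ∈ ℕ`, `i = 1, …, N`, are the particles of a bootstrap particle filter with `N`
particles and initial law `χ`, run on the observation sequence `Yobs`: given all the
observations, the initial particles are i.i.d. with law `χ`; given all the observations and the
particles up to time `n`, the particles at time `n + 1` are i.i.d. draws from the mixture of the
kernels `Q(ξ n j, ·)` with weights proportional to `g(ξ n j, Y_n)`. -/
structure IsBootstrapFilter (χ : Measure X) {Ω : Type*} [MeasurableSpace Ω] (P : Measure Ω)
    (Yobs : ℕ → Ω → Y) (N : ℕ) (ξ : ℕ → Fin N → Ω → X) : Prop where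
  measurable : ∀ n i, Measurable (ξ n i)
  init : ∀ A : Fin N → Set X, (∀ i, MeasurableSet (A i)) →
    P⟦{ω | ∀ i, ξ 0 i ω ∈ A i} | MeasurableSpace.comap (fun ω k => Yobs k ω) inferInstance⟧
      =ᵐ[P] fun _ => ∏ i, χ.real (A i)
  next : ∀ n, ∀ A : Fin N → Set X, (∀ i, MeasurableSet (A i)) →
    P⟦{ω | ∀ i, ξ (n + 1) i ω ∈ A i} |
        MeasurableSpace.comap (fun ω k => Yobs k ω) inferInstance ⊔
        MeasurableSpace.comap (fun ω (k : Fin (n + 1)) i => ξ k i ω) inferInstance⟧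
      =ᵐ[P] fun ω => ∏ i, (M.mixture (Yobs n ω) (fun j => ξ n j ω)).real (A i)

end HMM

/-- Strict stationarity of a process indexed by `ℕ`. -/
def IsStationarySeq {Ω Y : Type*} [MeasurableSpace Ω] [MeasurableSpace Y] (P : Measure Ω)
    (Yobs : ℕ → Ω → Y) : Prop :=
  P.map (fun ω k => Yobs (k + 1) ω) = P.map (fun ω k => Yobs k ω)

/-- The integral of `h` under the empirical measure of the sample `x`. -/
def empMean {X : Type*} (h : X → ℝ) {N : ℕ} (x : Fin N → X) : ℝ := (∑ i, h (x i)) / N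

end

/-! Fix the observations. Given the particles at time `n`, those at time `n + 1` are a sample from a
mixture, so the scaled error at time `n + 1` is a conditionally centered sampling error plus `√N`
times the bias of the mixture. The mixture is a ratio of two empirical means, hence up to a product
of two errors of order `N^(-1/2)` this second term is the scaled error at time `n` of a pulled-back
test function. The sampling error is asymptotically normal at a rate that does not depend on the law
sampled from, and by induction on `n` the scaled errors converge in law to a centered normal
distribution whose variance obeys the same recursion as `HMM.asympVar`. Hoeffding's lemma bounds
their exponential moments uniformly in `N`, which turns convergence in law into convergence of
moments. Finally, the conditional law of the particles at time `n` given all the observations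
depends only on the first `n` of them, and almost surely all the likelihoods are bounded, because
the law of `Y k` does not depend on `k`. -/

noncomputable section

lemma measurable_pi_const {α X ι : Type*} [MeasurableSpace α] [MeasurableSpace X] [Fintype ι]
    {μ : α → Measure X} [∀ a, IsFiniteMeasure (μ a)] (hμ : Measurable μ) :
    Measurable fun a => Measure.pi fun _ : ι => μ a := by
  have hcoe {A : ι → Set X} (hA : ∀ i, MeasurableSet (A i)) :
      Measurable fun a => (Measure.pi fun _ : ι => μ a) (Set.univ.pi A) := by
    simp only [Measure.pi_pi]
    exact Finset.measurable_prod _ fun i _ => (Measure.measurable_coe (hA i)).comp hμ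
  refine Measurable.measure_of_isPiSystem generateFrom_pi.symm isPiSystem_pi ?_ ?_
  · rintro _ ⟨A, hA, rfl⟩
    exact hcoe fun i => hA i (Set.mem_univ i)
  · simpa only [Set.pi_univ] using hcoe (A := fun _ => Set.univ) fun _ => .univ

lemma pi_const_univ_le_one {X ι : Type*} [MeasurableSpace X] [Fintype ι] {ρ : Measure X}
    [SigmaFinite ρ] (hρ : ρ Set.univ ≤ 1) : (Measure.pi fun _ : ι => ρ) Set.univ ≤ 1 := by
  rw [Measure.pi_univ]
  exact Finset.prod_le_one' fun _ _ => hρ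

lemma integral_comp_measure {α β E : Type*} [MeasurableSpace α] [MeasurableSpace β]
    [NormedAddCommGroup E] [NormedSpace ℝ E] {κ : Kernel α β} {μ : Measure α} {f : β → E}
    (hf : Integrable f (κ ∘ₘ μ)) : ∫ b, f b ∂(κ ∘ₘ μ) = ∫ a, ∫ b, f b ∂(κ a) ∂μ := by
  rw [Measure.comp_eq_comp_const_apply] at hf ⊢
  rw [Kernel.integral_comp hf, Kernel.const_apply]

/-- Bounded measurable real functions, the test functions against which measures on the state space
are compared. The bound holds everywhere, so that it is inherited by every law on `X`. -/
structure BddMeas {X : Type*} [MeasurableSpace X] (h : X → ℝ) : Prop where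
  measurable : Measurable h
  bdd : ∃ C, ∀ x, |h x| ≤ C

namespace BddMeas

variable {X : Type*} [MeasurableSpace X] {f h : X → ℝ}

lemma exists_bound (hh : BddMeas h) : ∃ C, 0 ≤ C ∧ ∀ x, |h x| ≤ C := by
  obtain ⟨C, hC⟩ := hh.bdd
  exact ⟨|C|, abs_nonneg _, fun x => (hC x).trans (le_abs_self C)⟩

lemma integrable (hh : BddMeas h) (μ : Measure X) [IsFiniteMeasure μ] : Integrable h μ := by
  obtain ⟨C, hC⟩ := hh.bdd
  exact Integrable.of_bound hh.measurable.aestronglyMeasurable C (ae_of_all _ hC)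

lemma memLp (hh : BddMeas h) (μ : Measure X) [IsFiniteMeasure μ] (p : ℝ≥0∞) : MemLp h p μ := by
  obtain ⟨C, hC⟩ := hh.bdd
  exact MemLp.of_bound hh.measurable.aestronglyMeasurable C (ae_of_all _ hC)

lemma const (c : ℝ) : BddMeas fun _ : X => c := ⟨measurable_const, |c|, fun _ => le_rfl⟩

lemma mul (hf : BddMeas f) (hh : BddMeas h) : BddMeas fun x => f x * h x := by
  obtain ⟨C, hC0, hC⟩ := hf.exists_bound
  obtain ⟨D, -, hD⟩ := hh.exists_bound
  refine ⟨hf.measurable.mul hh.measurable, C * D, fun x => ?_⟩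
  rw [abs_mul]
  exact mul_le_mul (hC x) (hD x) (abs_nonneg _) hC0

lemma sub (hf : BddMeas f) (hh : BddMeas h) : BddMeas fun x => f x - h x := by
  obtain ⟨C, hC⟩ := hf.bdd
  obtain ⟨D, hD⟩ := hh.bdd
  exact ⟨hf.measurable.sub hh.measurable, C + D,
    fun x => (abs_sub _ _).trans (add_le_add (hC x) (hD x))⟩

lemma div_const (hf : BddMeas f) (c : ℝ) : BddMeas fun x => f x / c := by
  simpa only [div_eq_mul_inv] using hf.mul (BddMeas.const c⁻¹)

lemma kernel_integral {Z : Type*} [MeasurableSpace Z] (hf : BddMeas f) (κ : Kernel Z X)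
    [IsFiniteKernel κ] : BddMeas fun z => ∫ x, f x ∂(κ z) := by
  obtain ⟨C, hC0, hC⟩ := hf.exists_bound
  refine ⟨(hf.measurable.stronglyMeasurable.integral_kernel (κ := κ)).measurable,
    C * κ.bound.toReal, fun z => ?_⟩
  refine (norm_integral_le_of_norm_le_const (μ := κ z) (f := f) (ae_of_all _ hC)).trans ?_
  refine mul_le_mul_of_nonneg_left ?_ hC0
  exact ENNReal.toReal_mono κ.bound_ne_top (Kernel.measure_le_bound _ _ _)

end BddMeas

lemma abs_integral_le_of_bound {X : Type*} [MeasurableSpace X] (ρ : Measure X)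
    [IsProbabilityMeasure ρ] {h : X → ℝ} {C : ℝ} (hC : ∀ x, |h x| ≤ C) : |∫ x, h x ∂ρ| ≤ C := by
  simpa using norm_integral_le_of_norm_le_const (μ := ρ) (f := h) (ae_of_all _ hC)

/-- The error of the empirical mean as an estimate of `c`, scaled by the square root of the sample
size. -/
def scaledError {X : Type*} (h : X → ℝ) (c : ℝ) {N : ℕ} (x : Fin N → X) : ℝ :=
  √(N : ℝ) * (empMean h x - c)

section ScaledError

variable {X : Type*}

lemma scaledError_eq_sum (h : X → ℝ) (c : ℝ) {N : ℕ} [NeZero N] (x : Fin N → X) :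
    scaledError h c x = (√(N : ℝ))⁻¹ * ∑ i, (h (x i) - c) := by
  have hN : (0 : ℝ) < N := by exact_mod_cast NeZero.pos N
  have hsqrt : √(N : ℝ) ^ 2 = N := Real.sq_sqrt hN.le
  have hsqrt_pos := Real.sqrt_pos.2 hN
  rw [Finset.sum_sub_distrib, scaledError, empMean]
  simp only [Finset.sum_const, Finset.card_univ, Fintype.card_fin, nsmul_eq_mul]
  field_simp
  rw [hsqrt]

lemma measurable_scaledError [MeasurableSpace X] {h : X → ℝ} (hh : Measurable h) (c : ℝ) (N : ℕ) :
    Measurable fun x : Fin N → X => scaledError h c x := by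
  unfold scaledError empMean
  fun_prop

end ScaledError

section CharFun

open Complex

lemma norm_pow_sub_pow_le_mul {a b : ℂ} (ha : ‖a‖ ≤ 1) (hb : ‖b‖ ≤ 1) (N : ℕ) :
    ‖a ^ N - b ^ N‖ ≤ N * ‖a - b‖ := by
  induction N with
  | zero => simp
  | succ N ih =>
    calc ‖a ^ (N + 1) - b ^ (N + 1)‖ = ‖a ^ N * (a - b) + (a ^ N - b ^ N) * b‖ := by ring_nf
      _ ≤ ‖a‖ ^ N * ‖a - b‖ + ‖a ^ N - b ^ N‖ * ‖b‖ := by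
          rw [← norm_pow, ← norm_mul, ← norm_mul]
          exact norm_add_le _ _
      _ ≤ 1 * ‖a - b‖ + N * ‖a - b‖ * 1 := by
          gcongr
          exact pow_le_one₀ (norm_nonneg _) ha
      _ = (N + 1 : ℕ) * ‖a - b‖ := by push_cast; ring

lemma norm_cexp_mul_I_sub_quadratic_le (u : ℝ) :
    ‖cexp (u * I) - (1 + u * I - (u ^ 2 / 2 : ℝ))‖ ≤ |u| ^ 3 * Real.exp |u| := by
  have htaylor := norm_exp_sub_sum_le_norm_mul_exp (u * I) 3
  rw [norm_mul, norm_I, mul_one, norm_real, Real.norm_eq_abs] at htaylor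
  convert htaylor using 3
  simp only [Finset.sum_range_succ, Finset.sum_range_zero, Nat.factorial, mul_pow, I_sq]
  push_cast
  ring

lemma abs_exp_neg_sub_one_sub_le {w : ℝ} (hw : 0 ≤ w) :
    |Real.exp (-w) - (1 - w)| ≤ w ^ 2 * Real.exp w := by
  have htaylor := norm_exp_sub_sum_le_norm_mul_exp ((-w : ℝ) : ℂ) 2
  rw [norm_real, Real.norm_eq_abs, abs_neg, abs_of_nonneg hw] at htaylor
  rw [← Real.norm_eq_abs, ← norm_real]
  convert htaylor using 3
  simp [Finset.sum_range_succ, sub_eq_add_neg]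

lemma norm_pow_sub_exp_le {z : ℂ} {N : ℕ} {s v A B : ℝ} (hs0 : 0 ≤ s) (hs1 : s ≤ 1)
    (hNs : N * s ^ 2 = 1) (hv0 : 0 ≤ v) (hvB : v ≤ B) (hz : ‖z‖ ≤ 1)
    (hzA : ‖z - (1 - s ^ 2 * v / 2 : ℝ)‖ ≤ s ^ 3 * A) :
    ‖z ^ N - Real.exp (-v / 2)‖ ≤ (A + B ^ 2 * Real.exp B) * s := by
  set w := s ^ 2 * v / 2 with hw
  have hw0 : 0 ≤ w := by positivity
  have hexp_pow : ((Real.exp (-v / 2) : ℝ) : ℂ) = ((Real.exp (-w) : ℝ) : ℂ) ^ N := by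
    rw [← ofReal_pow, ← Real.exp_nat_mul]
    congr 2
    linear_combination (v / 2) * hNs
  have hnorm_exp : ‖((Real.exp (-w) : ℝ) : ℂ)‖ ≤ 1 := by
    rw [norm_real, Real.norm_of_nonneg (Real.exp_pos _).le]
    exact Real.exp_le_one_iff.2 (by linarith)
  have hexp : |Real.exp (-w) - (1 - w)| ≤ s ^ 3 * (B ^ 2 * Real.exp B) := by
    have hB0 : 0 ≤ B := hv0.trans hvB
    have hwB : w ≤ s ^ 2 * B := by nlinarith [mul_le_mul_of_nonneg_left hvB (sq_nonneg s)]
    have hwB' : w ≤ B := hwB.trans (mul_le_of_le_one_left hB0 (pow_le_one₀ hs0 hs1))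
    calc _ ≤ w ^ 2 * Real.exp w := abs_exp_neg_sub_one_sub_le hw0
      _ ≤ (s ^ 2 * B) ^ 2 * Real.exp B := by gcongr
      _ = s * (s ^ 3 * (B ^ 2 * Real.exp B)) := by ring
      _ ≤ _ := mul_le_of_le_one_left (by positivity) hs1
  calc _ ≤ N * ‖z - (Real.exp (-w) : ℝ)‖ := by
        rw [hexp_pow]
        exact norm_pow_sub_pow_le_mul hz hnorm_exp N
    _ ≤ N * (s ^ 3 * A + s ^ 3 * (B ^ 2 * Real.exp B)) := by
        gcongr
        refine (norm_sub_le_norm_sub_add_norm_sub _ ((1 - w : ℝ) : ℂ) _).trans (add_le_add hzA ?_)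
        rwa [← ofReal_sub, norm_real, Real.norm_eq_abs, abs_sub_comm]
    _ = N * s ^ 2 * ((A + B ^ 2 * Real.exp B) * s) := by ring
    _ = _ := by rw [hNs, one_mul]

lemma norm_cexp_mul_I_sub_le (a b : ℝ) : ‖cexp (a * I) - cexp (b * I)‖ ≤ |a - b| := by
  have hfactor : cexp (a * I) - cexp (b * I) = cexp (b * I) * (cexp (I * (a - b : ℝ)) - 1) := by
    rw [mul_sub, ← Complex.exp_add, mul_one]
    congr 2
    push_cast
    ring
  rw [hfactor, norm_mul, norm_exp_ofReal_mul_I, one_mul]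
  exact Real.norm_exp_I_mul_ofReal_sub_one_le

lemma abs_exp_neg_half_sub_le {a b : ℝ} (ha : 0 ≤ a) (hb : 0 ≤ b) :
    |Real.exp (-a / 2) - Real.exp (-b / 2)| ≤ |a - b| / 2 := by
  wlog hab : a ≤ b generalizing a b
  · rw [abs_sub_comm, abs_sub_comm a]
    exact this hb ha (le_of_not_ge hab)
  have hanti : Real.exp (-b / 2) ≤ Real.exp (-a / 2) := Real.exp_le_exp.2 (by linarith)
  have hfactor : Real.exp (-b / 2) = Real.exp (-a / 2) * Real.exp (-(b - a) / 2) := by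
    rw [← Real.exp_add]; congr 1; ring
  have htangent := Real.add_one_le_exp (-(b - a) / 2)
  have hle_one : Real.exp (-a / 2) ≤ 1 := Real.exp_le_one_iff.2 (by linarith)
  rw [abs_of_nonneg (by linarith), abs_of_nonpos (by linarith), hfactor]
  nlinarith [Real.exp_pos (-a / 2)]

lemma norm_cexp_mul_sub_le {J : ℂ} {a b v w δ : ℝ} (hv : 0 ≤ v) (hw : 0 ≤ w)
    (hJ : ‖J - Real.exp (-v / 2)‖ ≤ δ) :
    ‖cexp (a * I) * J - cexp (b * I) * Real.exp (-w / 2)‖ ≤ δ + |v - w| / 2 + |a - b| := by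
  have hexp : ‖((Real.exp (-v / 2) : ℝ) : ℂ) - Real.exp (-w / 2)‖ ≤ |v - w| / 2 := by
    rw [← ofReal_sub, norm_real, Real.norm_eq_abs]
    exact abs_exp_neg_half_sub_le hv hw
  have hexp_le_one : ‖((Real.exp (-w / 2) : ℝ) : ℂ)‖ ≤ 1 := by
    rw [norm_real, Real.norm_of_nonneg (Real.exp_pos _).le]
    exact Real.exp_le_one_iff.2 (by linarith)
  calc _ = ‖cexp (a * I) * (J - Real.exp (-v / 2))
          + cexp (a * I) * (Real.exp (-v / 2) - Real.exp (-w / 2))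
          + (cexp (a * I) - cexp (b * I)) * Real.exp (-w / 2)‖ := by
        ring_nf
    _ ≤ ‖J - Real.exp (-v / 2)‖ + ‖((Real.exp (-v / 2) : ℝ) : ℂ) - Real.exp (-w / 2)‖
          + ‖cexp (a * I) - cexp (b * I)‖ * ‖((Real.exp (-w / 2) : ℝ) : ℂ)‖ := by
        refine norm_add₃_le.trans_eq ?_
        simp only [norm_mul, norm_exp_ofReal_mul_I, one_mul]
    _ ≤ _ := by
        gcongr
        exact (mul_le_of_le_one_right (norm_nonneg _) hexp_le_one).trans
          (norm_cexp_mul_I_sub_le a b)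

variable {X : Type*} [MeasurableSpace X] {Z : X → ℝ} {C : ℝ}

lemma integrable_cexp_mul_I (hZ : Measurable Z) (μ : Measure X) [IsFiniteMeasure μ] :
    Integrable (fun x => cexp (Z x * I)) μ :=
  Integrable.of_bound (C := 1) (Measurable.aestronglyMeasurable (by fun_prop))
    (ae_of_all _ fun x => (norm_exp_ofReal_mul_I _).le)

lemma norm_integral_cexp_mul_I_le_one (Z : X → ℝ) (μ : Measure X) [IsProbabilityMeasure μ] :
    ‖∫ x, cexp (Z x * I) ∂μ‖ ≤ 1 := by
  simpa using norm_integral_le_of_norm_le_const (μ := μ) (f := fun x => cexp (Z x * I))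
    (ae_of_all _ fun x => (norm_exp_ofReal_mul_I _).le)

lemma norm_integral_cexp_sub_quadratic_le (ρ : Measure X) [IsProbabilityMeasure ρ]
    (hZ : Measurable Z) (hC : ∀ x, |Z x| ≤ C) (hmean : ∫ x, Z x ∂ρ = 0)
    {s : ℝ} (hs0 : 0 ≤ s) (hs1 : s ≤ 1) :
    ‖∫ x, cexp ((s * Z x : ℝ) * I) ∂ρ - (1 - s ^ 2 * (∫ x, Z x ^ 2 ∂ρ) / 2 : ℝ)‖
      ≤ s ^ 3 * (C ^ 3 * Real.exp C) := by
  have hZb : BddMeas Z := ⟨hZ, C, hC⟩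
  have hint : Integrable (fun x => ((s * Z x : ℝ) : ℂ) * I) ρ :=
    ((hZb.integrable ρ).const_mul s).ofReal.mul_const I
  have hint_sq : Integrable (fun x => (((s * Z x) ^ 2 / 2 : ℝ) : ℂ)) ρ := by
    simp only [mul_pow, pow_two (Z _)]
    exact ((((hZb.mul hZb).integrable ρ).const_mul _).div_const 2).ofReal
  have hint_lin : Integrable (fun x => 1 + ((s * Z x : ℝ) : ℂ) * I) ρ :=
    (integrable_const 1).add hint
  have hquad : ∫ x, (1 + ((s * Z x : ℝ) : ℂ) * I - ((s * Z x) ^ 2 / 2 : ℝ)) ∂ρ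
      = (1 - s ^ 2 * (∫ x, Z x ^ 2 ∂ρ) / 2 : ℝ) := by
    rw [integral_sub hint_lin hint_sq, integral_add (integrable_const 1) hint,
      integral_mul_const, integral_complex_ofReal, integral_complex_ofReal]
    simp only [mul_pow, integral_div, integral_const_mul, hmean]
    simp
  have hint_quad : Integrable (fun x => 1 + ((s * Z x : ℝ) : ℂ) * I - ((s * Z x) ^ 2 / 2 : ℝ)) ρ :=
    hint_lin.sub hint_sq
  rw [← hquad, ← integral_sub (integrable_cexp_mul_I (hZ.const_mul s) ρ) hint_quad]
  refine (norm_integral_le_of_norm_le_const (ae_of_all _ fun x => ?_)).trans_eq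
    (by rw [probReal_univ, mul_one])
  refine (norm_cexp_mul_I_sub_quadratic_le (s * Z x)).trans ?_
  rw [abs_mul, abs_of_nonneg hs0, mul_pow, mul_assoc]
  have hC0 : 0 ≤ C := (abs_nonneg (Z x)).trans (hC x)
  have hsC : s * |Z x| ≤ C := (mul_le_of_le_one_left (abs_nonneg _) hs1).trans (hC x)
  gcongr
  exact hC x

lemma norm_integral_cexp_pow_sub_exp_le (ρ : Measure X) [IsProbabilityMeasure ρ]
    (hZ : Measurable Z) (hC : ∀ x, |Z x| ≤ C) (hmean : ∫ x, Z x ∂ρ = 0) (N : ℕ) [NeZero N] :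
    ‖(∫ x, cexp (((√(N : ℝ))⁻¹ * Z x : ℝ) * I) ∂ρ) ^ N
        - Real.exp (-(∫ x, Z x ^ 2 ∂ρ) / 2)‖
      ≤ (C ^ 3 * Real.exp C + (C ^ 2) ^ 2 * Real.exp (C ^ 2)) / √(N : ℝ) := by
  have hN : (1 : ℝ) ≤ N := by exact_mod_cast NeZero.one_le (n := N)
  have hs1 : (√(N : ℝ))⁻¹ ≤ 1 := inv_le_one_of_one_le₀ (Real.one_le_sqrt.2 hN)
  have hNs : N * (√(N : ℝ))⁻¹ ^ 2 = 1 := by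
    rw [inv_pow, Real.sq_sqrt (by linarith), mul_inv_cancel₀ (by linarith)]
  have hvar : ∫ x, Z x ^ 2 ∂ρ ≤ C ^ 2 :=
    (le_abs_self _).trans <| abs_integral_le_of_bound ρ fun x => by
      rw [abs_pow]
      exact pow_le_pow_left₀ (abs_nonneg _) (hC x) 2
  rw [div_eq_mul_inv]
  exact norm_pow_sub_exp_le (by positivity) hs1 hNs (integral_nonneg fun x => sq_nonneg _) hvar
    (norm_integral_cexp_mul_I_le_one _ ρ)
    (norm_integral_cexp_sub_quadratic_le ρ hZ hC hmean (by positivity) hs1)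

/-- The rate has to be uniform in `ρ`: the sample will be drawn from the random mixture. -/
lemma exists_norm_integral_cexp_scaledError_sub_le {h : X → ℝ} (hh : BddMeas h) :
    ∃ D, 0 ≤ D ∧ ∀ (ρ : Measure X) [IsProbabilityMeasure ρ] (N : ℕ) [NeZero N],
      ‖∫ x, cexp (scaledError h (∫ z, h z ∂ρ) x * I) ∂(Measure.pi fun _ : Fin N => ρ)
          - Real.exp (-Var[h; ρ] / 2)‖ ≤ D / √(N : ℝ) := by
  obtain ⟨C, hC0, hC⟩ := hh.exists_bound
  refine ⟨(2 * C) ^ 3 * Real.exp (2 * C) + ((2 * C) ^ 2) ^ 2 * Real.exp ((2 * C) ^ 2),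
    by positivity, fun ρ _ N _ => ?_⟩
  set m := ∫ z, h z ∂ρ with hm
  have hcentered (x : X) : |h x - m| ≤ 2 * C := by
    have hm : |m| ≤ C := abs_integral_le_of_bound ρ hC
    linarith [abs_sub (h x) m, hC x]
  have hmean : ∫ x, (h x - m) ∂ρ = 0 := by
    rw [integral_sub (hh.integrable ρ) (integrable_const m)]
    simp [hm]
  have hprod (x : Fin N → X) : cexp (scaledError h m x * I)
      = ∏ i, cexp (((√(N : ℝ))⁻¹ * (h (x i) - m) : ℝ) * I) := by
    rw [scaledError_eq_sum, Finset.mul_sum, ofReal_sum, Finset.sum_mul, Complex.exp_sum]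
  simp_rw [hprod]
  rw [integral_fintype_prod_eq_pow (ι := Fin N)
    (fun z => cexp (((√(N : ℝ))⁻¹ * (h z - m) : ℝ) * I)), Fintype.card_fin,
    variance_eq_integral hh.measurable.aemeasurable]
  exact norm_integral_cexp_pow_sub_exp_le ρ (hh.measurable.sub_const m) hcentered hmean N

end CharFun

section ExpMoments

open NNReal

lemma lintegral_exp_mul_abs_le_of_hasSubgaussianMGF {E : Type*} [MeasurableSpace E]
    {μ : Measure E} {Z : E → ℝ} {c : ℝ≥0} (hZ : HasSubgaussianMGF Z c μ) (t : ℝ) :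
    ∫⁻ x, ENNReal.ofReal (Real.exp (t * |Z x|)) ∂μ
      ≤ ENNReal.ofReal (2 * Real.exp (c * t ^ 2 / 2)) := by
  have hmgf (s : ℝ) : ∫⁻ x, ENNReal.ofReal (Real.exp (s * Z x)) ∂μ
      ≤ ENNReal.ofReal (Real.exp (c * s ^ 2 / 2)) := by
    rw [← ofReal_integral_eq_lintegral_ofReal (hZ.integrable_exp_mul s)
      (ae_of_all _ fun x => (Real.exp_pos _).le)]
    exact ENNReal.ofReal_le_ofReal (hZ.mgf_le s)
  have hpointwise (z : ℝ) : ENNReal.ofReal (Real.exp (t * |z|))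
      ≤ ENNReal.ofReal (Real.exp (t * z)) + ENNReal.ofReal (Real.exp (-t * z)) := by
    rcases abs_choice z with hz | hz <;> rw [hz]
    · exact le_self_add
    · rw [mul_neg, ← neg_mul]
      exact le_add_self
  calc _ ≤ ∫⁻ x, ENNReal.ofReal (Real.exp (t * Z x)) + ENNReal.ofReal (Real.exp (-t * Z x)) ∂μ :=
        lintegral_mono fun x => hpointwise (Z x)
    _ = ∫⁻ x, ENNReal.ofReal (Real.exp (t * Z x)) ∂μ
          + ∫⁻ x, ENNReal.ofReal (Real.exp (-t * Z x)) ∂μ :=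
        lintegral_add_left'
          (hZ.integrable_exp_mul t).aestronglyMeasurable.aemeasurable.ennreal_ofReal _
    _ ≤ ENNReal.ofReal (Real.exp (c * t ^ 2 / 2)) + ENNReal.ofReal (Real.exp (c * t ^ 2 / 2)) :=
        add_le_add (hmgf t) (by simpa using hmgf (-t))
    _ = _ := by
        rw [← ENNReal.ofReal_add (Real.exp_pos _).le (Real.exp_pos _).le, two_mul]

lemma hasSubgaussianMGF_scaledError {X : Type*} [MeasurableSpace X] (ρ : Measure X)
    [IsProbabilityMeasure ρ] {h : X → ℝ} (hh : Measurable h) {C : ℝ≥0} (hC : ∀ x, |h x| ≤ C)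
    (N : ℕ) [NeZero N] :
    HasSubgaussianMGF (fun x : Fin N → X => scaledError h (∫ z, h z ∂ρ) x) (C ^ 2)
      (Measure.pi fun _ => ρ) := by
  have hN : (N : ℝ) ≠ 0 := by exact_mod_cast NeZero.ne N
  have hone : HasSubgaussianMGF (fun z => h z - ∫ z, h z ∂ρ) (C ^ 2) ρ := by
    convert! hasSubgaussianMGF_of_mem_Icc (μ := ρ) hh.aemeasurable
      (ae_of_all _ fun x => abs_le.1 (hC x)) using 1
    rw [sub_neg_eq_add, ← two_mul]
    simp
  have hterm (i : Fin N) : HasSubgaussianMGF (fun x : Fin N → X => h (x i) - ∫ z, h z ∂ρ) (C ^ 2)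
      (Measure.pi fun _ => ρ) := by
    have heval := measurePreserving_eval (fun _ : Fin N => ρ) i
    rw [← heval.map_eq] at hone
    simpa only [heval.map_eq] using! hone.of_map heval.measurable.aemeasurable
  have hsum := (HasSubgaussianMGF.sum_of_iIndepFun (s := Finset.univ)
    (iIndepFun_pi fun _ => (hh.sub_const (∫ z, h z ∂ρ)).aemeasurable)
    fun i _ => hterm i).const_mul (√(N : ℝ))⁻¹
  simp_rw [scaledError_eq_sum]
  convert! hsum using 1
  ext
  change (C : ℝ) ^ 2 = (√(N : ℝ))⁻¹ ^ 2 * ((∑ _i : Fin N, C ^ 2 : ℝ≥0) : ℝ)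
  rw [inv_pow, Real.sq_sqrt N.cast_nonneg]
  simp only [Finset.sum_const, Finset.card_univ, Fintype.card_fin, nsmul_eq_mul, NNReal.coe_mul,
    NNReal.coe_natCast, NNReal.coe_pow]
  field_simp

lemma exists_forall_lintegral_exp_mul_abs_scaledError_le {X : Type*} [MeasurableSpace X] {h : X → ℝ}
    (hh : BddMeas h) (t : ℝ) :
    ∃ K : ℝ≥0, ∀ (ρ : Measure X) [IsProbabilityMeasure ρ] (N : ℕ) [NeZero N],
      ∫⁻ x, ENNReal.ofReal (Real.exp (t * |scaledError h (∫ z, h z ∂ρ) x|))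
        ∂(Measure.pi fun _ : Fin N => ρ) ≤ K := by
  obtain ⟨C, hC0, hC⟩ := hh.exists_bound
  lift C to ℝ≥0 using hC0
  exact ⟨Real.toNNReal (2 * Real.exp ((C ^ 2 : ℝ≥0) * t ^ 2 / 2)), fun ρ _ N _ =>
    lintegral_exp_mul_abs_le_of_hasSubgaussianMGF
      (hasSubgaussianMGF_scaledError ρ hh.measurable hC N) t⟩

/-- The variables `Z i`, on possibly different spaces `E i`, have exponential moments of all orders,
bounded uniformly in `i`. Integrability is expressed through the lower Lebesgue integral. -/
def UnifExpMoments {ι : Type*} {E : ι → Type*} [∀ i, MeasurableSpace (E i)]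
    (μ : ∀ i, Measure (E i)) (Z : ∀ i, E i → ℝ) : Prop :=
  ∀ t, 0 ≤ t → ∃ K : ℝ≥0, ∀ i, ∫⁻ x, ENNReal.ofReal (Real.exp (t * |Z i x|)) ∂(μ i) ≤ K

namespace UnifExpMoments

variable {ι : Type*} {E F : ι → Type*} [∀ i, MeasurableSpace (E i)] [∀ i, MeasurableSpace (F i)]
  {μ : ∀ i, Measure (E i)} {Z W : ∀ i, E i → ℝ}

lemma mono (hW : UnifExpMoments μ W) (hZW : ∀ i x, |Z i x| ≤ |W i x|) : UnifExpMoments μ Z := by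
  intro t ht
  obtain ⟨K, hK⟩ := hW t ht
  refine ⟨K, fun i => (lintegral_mono fun x => ?_).trans (hK i)⟩
  have := hZW i x
  gcongr

lemma abs (hZ : UnifExpMoments μ Z) : UnifExpMoments μ fun i x => |Z i x| :=
  hZ.mono fun _ _ => (abs_abs _).le

lemma const_mul (c : ℝ) (hZ : UnifExpMoments μ Z) : UnifExpMoments μ fun i x => c * Z i x := by
  intro t ht
  obtain ⟨K, hK⟩ := hZ (t * |c|) (by positivity)
  exact ⟨K, fun i => by simpa only [abs_mul, mul_assoc] using hK i⟩

lemma add (hZm : ∀ i, Measurable (Z i)) (hZ : UnifExpMoments μ Z) (hW : UnifExpMoments μ W) :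
    UnifExpMoments μ fun i x => Z i x + W i x := by
  intro t ht
  obtain ⟨K, hK⟩ := hZ (2 * t) (by positivity)
  obtain ⟨K', hK'⟩ := hW (2 * t) (by positivity)
  refine ⟨K + K', fun i => ?_⟩
  have hpointwise (x : E i) : ENNReal.ofReal (Real.exp (t * |Z i x + W i x|))
      ≤ ENNReal.ofReal (Real.exp (2 * t * |Z i x|))
        + ENNReal.ofReal (Real.exp (2 * t * |W i x|)) := by
    have htri : t * |Z i x + W i x| ≤ t * (|Z i x| + |W i x|) := by
      gcongr
      exact abs_add_le _ _
    rcases le_total |Z i x| |W i x| with hle | hle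
    · refine le_add_left (ENNReal.ofReal_le_ofReal (Real.exp_le_exp.2 ?_))
      nlinarith
    · refine le_add_right (ENNReal.ofReal_le_ofReal (Real.exp_le_exp.2 ?_))
      nlinarith
  calc _ ≤ ∫⁻ x, ENNReal.ofReal (Real.exp (2 * t * |Z i x|))
            + ENNReal.ofReal (Real.exp (2 * t * |W i x|)) ∂(μ i) := lintegral_mono hpointwise
    _ = _ := lintegral_add_left (by have := hZm i; fun_prop) _
    _ ≤ _ := by
        rw [ENNReal.coe_add]
        exact add_le_add (hK i) (hK' i)

lemma comp_kernel (hW : UnifExpMoments μ W) (η : ∀ i, Kernel (E i) (F i)) {Z : ∀ i, F i → ℝ}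
    (hZm : ∀ i, Measurable (Z i))
    (hZ : ∀ t, 0 ≤ t → ∃ K : ℝ≥0, ∀ i x, ∫⁻ x', ENNReal.ofReal (Real.exp (t * |Z i x'|)) ∂(η i x)
      ≤ K * ENNReal.ofReal (Real.exp (t * |W i x|))) :
    UnifExpMoments (fun i => η i ∘ₘ μ i) Z := by
  intro t ht
  obtain ⟨K, hK⟩ := hZ t ht
  obtain ⟨K', hK'⟩ := hW t ht
  refine ⟨K * K', fun i => ?_⟩
  rw [Measure.lintegral_bind (Kernel.aemeasurable _) (by have := hZm i; fun_prop)]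
  calc _ ≤ ∫⁻ x, K * ENNReal.ofReal (Real.exp (t * |W i x|)) ∂(μ i) := lintegral_mono (hK i)
    _ = K * ∫⁻ x, ENNReal.ofReal (Real.exp (t * |W i x|)) ∂(μ i) :=
        lintegral_const_mul' _ _ ENNReal.coe_ne_top
    _ ≤ K * K' := by gcongr; exact hK' i
    _ = _ := (ENNReal.coe_mul _ _).symm

lemma exists_forall_integral_le_of_le_exp (hZ : UnifExpMoments μ Z) {f : ℝ → ℝ}
    (hf : Measurable f) {A : ℝ} (hA : 0 ≤ A) (hfexp : ∀ z, |f z| ≤ A * Real.exp |z|)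
    (hZm : ∀ i, Measurable (Z i)) :
    ∃ K : ℝ, ∀ i, Integrable (fun x => f (Z i x)) (μ i) ∧ ∫ x, |f (Z i x)| ∂(μ i) ≤ K := by
  obtain ⟨K, hK⟩ := hZ 1 zero_le_one
  refine ⟨A * K, fun i => ?_⟩
  have hlint : ∫⁻ x, ‖f (Z i x)‖ₑ ∂(μ i) ≤ ENNReal.ofReal A * K := by
    calc _ ≤ ∫⁻ x, ENNReal.ofReal A * ENNReal.ofReal (Real.exp (1 * |Z i x|)) ∂(μ i) := by
          refine lintegral_mono fun x => ?_
          rw [← ofReal_norm, ← ENNReal.ofReal_mul hA, Real.norm_eq_abs, one_mul]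
          exact ENNReal.ofReal_le_ofReal (hfexp _)
      _ = _ := lintegral_const_mul' _ _ ENNReal.ofReal_ne_top
      _ ≤ _ := by gcongr; exact hK i
  have htop : ENNReal.ofReal A * K ≠ ∞ :=
    ENNReal.mul_ne_top ENNReal.ofReal_ne_top ENNReal.coe_ne_top
  have hfZ : AEStronglyMeasurable (fun x => f (Z i x)) (μ i) :=
    (hf.comp (hZm i)).aestronglyMeasurable
  refine ⟨⟨hfZ, hlint.trans_lt htop.lt_top⟩, ?_⟩
  have hreal := ENNReal.toReal_mono htop hlint
  rw [← integral_norm_eq_lintegral_enorm hfZ] at hreal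
  simpa [ENNReal.toReal_ofReal hA] using hreal

lemma exists_forall_integral_sq_le (hZ : UnifExpMoments μ Z) (hZm : ∀ i, Measurable (Z i)) :
    ∃ K : ℝ, ∀ i, Integrable (fun x => Z i x ^ 2) (μ i) ∧ ∫ x, Z i x ^ 2 ∂(μ i) ≤ K := by
  have hsq (z : ℝ) : |z ^ 2| ≤ 2 * Real.exp |z| := by
    have := Real.quadratic_le_exp_of_nonneg (abs_nonneg z)
    rw [abs_pow]
    nlinarith [abs_nonneg z]
  simpa only [abs_pow, sq_abs] using
    hZ.exists_forall_integral_le_of_le_exp (f := (· ^ 2)) (by fun_prop) zero_le_two hsq hZm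

end UnifExpMoments

end ExpMoments

section Moments

lemma exists_abs_rpow_le_mul_exp {q : ℝ} (hq : 0 ≤ q) :
    ∃ C, 0 ≤ C ∧ ∀ x : ℝ, |x| ^ q ≤ C * Real.exp |x| := by
  obtain ⟨k, hk⟩ := exists_nat_ge q
  refine ⟨1 + k.factorial, by positivity, fun x => ?_⟩
  have hpow : |x| ^ k ≤ k.factorial * Real.exp |x| :=
    (div_le_iff₀' (by positivity)).1 (Real.pow_div_factorial_le_exp |x| (abs_nonneg x) k)
  have hexp : (1 : ℝ) ≤ Real.exp |x| := Real.one_le_exp (abs_nonneg x)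
  rw [add_mul, one_mul]
  rcases le_total |x| 1 with hx | hx
  · have hone : |x| ^ q ≤ 1 := Real.rpow_le_one (abs_nonneg _) hx hq
    linarith [mul_nonneg k.factorial.cast_nonneg (Real.exp_pos |x|).le]
  · have hmono : |x| ^ q ≤ |x| ^ (k : ℝ) := Real.rpow_le_rpow_of_exponent_le hx hk
    rw [Real.rpow_natCast] at hmono
    linarith

lemma UnifExpMoments.exists_forall_integral_abs_rpow_le {ι : Type*} {E : ι → Type*}
    [∀ i, MeasurableSpace (E i)] {μ : ∀ i, Measure (E i)} {Z : ∀ i, E i → ℝ}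
    (hZ : UnifExpMoments μ Z) (hZm : ∀ i, Measurable (Z i)) {q : ℝ} (hq : 0 ≤ q) :
    ∃ K : ℝ, ∀ i, Integrable (fun x => |Z i x| ^ q) (μ i) ∧ ∫ x, |Z i x| ^ q ∂(μ i) ≤ K := by
  obtain ⟨C, hC0, hC⟩ := exists_abs_rpow_le_mul_exp hq
  have habs (z : ℝ) : |(|z| ^ q)| = |z| ^ q := abs_of_nonneg (by positivity)
  simpa only [habs] using hZ.exists_forall_integral_le_of_le_exp (f := fun z => |z| ^ q)
    (by fun_prop) hC0 (fun z => (habs z).trans_le (hC z)) hZm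

/-- The truncated absolute power `x ↦ min (|x| ^ p) A`, as a test function for weak convergence. -/
def truncRpow {p : ℝ} (hp : 0 ≤ p) {A : ℝ} (hA : 0 ≤ A) : BoundedContinuousFunction ℝ ℝ :=
  BoundedContinuousFunction.ofNormedAddCommGroup (fun x => min (|x| ^ p) A)
    ((continuous_abs.rpow_const fun _ => Or.inr hp).min continuous_const) A fun x => by
      rw [Real.norm_of_nonneg (by positivity)]
      exact min_le_right _ _

lemma sub_min_le_sq_div {a A : ℝ} (hA : 0 < A) : a - min a A ≤ a ^ 2 / A := by
  rcases le_total a A with h | h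
  · rw [min_eq_left h, sub_self]
    positivity
  · rw [min_eq_right h, le_div_iff₀ hA]
    nlinarith

lemma abs_integral_rpow_sub_truncRpow_le {μ : Measure ℝ} [IsProbabilityMeasure μ] {p A : ℝ}
    (hp : 0 ≤ p) (hA : 0 < A) (hint : Integrable (fun x => |x| ^ (2 * p)) μ) :
    |∫ x, |x| ^ p ∂μ - ∫ x, truncRpow hp hA.le x ∂μ| ≤ (∫ x, |x| ^ (2 * p) ∂μ) / A := by
  have hsq (x : ℝ) : |x| ^ (2 * p) = (|x| ^ p) ^ 2 := by
    rw [mul_comm, Real.rpow_mul (abs_nonneg x), Real.rpow_two]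
  have hint_p : Integrable (fun x => |x| ^ p) μ := by
    refine ((integrable_const 1).add hint).mono' (by fun_prop) (ae_of_all _ fun x => ?_)
    rw [Real.norm_of_nonneg (by positivity), Pi.add_apply, hsq]
    nlinarith [sq_nonneg (|x| ^ p - 1), sq_nonneg (|x| ^ p)]
  have hint_trunc : Integrable (truncRpow hp hA.le) μ := (truncRpow hp hA.le).integrable μ
  rw [← integral_sub hint_p hint_trunc, ← integral_div, ← Real.norm_eq_abs]
  refine norm_integral_le_of_norm_le (hint.div_const A) (ae_of_all _ fun x => ?_)
  change ‖|x| ^ p - min (|x| ^ p) A‖ ≤ _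
  rw [Real.norm_of_nonneg (sub_nonneg.2 (min_le_left _ _)), hsq]
  exact sub_min_le_sq_div hA

lemma tendsto_integral_abs_rpow_of_bounded {ι : Type*} {l : Filter ι} {μ : ι → ProbabilityMeasure ℝ}
    {μ₀ : ProbabilityMeasure ℝ} (hμ : Tendsto μ l (𝓝 μ₀)) {p K : ℝ} (hp : 0 ≤ p)
    (hint : ∀ i, Integrable (fun x => |x| ^ (2 * p)) (μ i : Measure ℝ))
    (hK : ∀ i, ∫ x, |x| ^ (2 * p) ∂(μ i : Measure ℝ) ≤ K)
    (hint₀ : Integrable (fun x => |x| ^ (2 * p)) (μ₀ : Measure ℝ)) :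
    Tendsto (fun i => ∫ x, |x| ^ p ∂(μ i : Measure ℝ)) l (𝓝 (∫ x, |x| ^ p ∂(μ₀ : Measure ℝ))) := by
  set K' := max (max K (∫ x, |x| ^ (2 * p) ∂(μ₀ : Measure ℝ))) 0
  have hK' : K ≤ K' := (le_max_left _ _).trans (le_max_left _ _)
  have hK'₀ : ∫ x, |x| ^ (2 * p) ∂(μ₀ : Measure ℝ) ≤ K' :=
    (le_max_right _ _).trans (le_max_left _ _)
  have hK'0 : 0 ≤ K' := le_max_right _ _
  rw [Metric.tendsto_nhds]
  intro ε hε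
  obtain ⟨A, hA, hKA⟩ : ∃ A, 0 < A ∧ K' / A < ε / 3 := by
    refine ⟨3 * (K' + 1) / ε, by positivity, ?_⟩
    rw [div_lt_iff₀ (by positivity)]
    field_simp
    linarith
  have htrunc := ProbabilityMeasure.tendsto_iff_forall_integral_tendsto.1 hμ (truncRpow hp hA.le)
  filter_upwards [Metric.tendsto_nhds.1 htrunc (ε / 3) (by positivity)] with i htrunc_i
  have hcut_i := (abs_integral_rpow_sub_truncRpow_le hp hA (hint i)).trans
    (div_le_div_of_nonneg_right ((hK i).trans hK') hA.le)
  have hcut₀ := (abs_integral_rpow_sub_truncRpow_le hp hA hint₀).trans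
    (div_le_div_of_nonneg_right hK'₀ hA.le)
  rw [Real.dist_eq] at htrunc_i ⊢
  rw [abs_le] at hcut_i hcut₀
  rw [abs_lt] at htrunc_i ⊢
  constructor <;> linarith [hcut_i.1, hcut_i.2, hcut₀.1, hcut₀.2, htrunc_i.1, htrunc_i.2]

lemma integrable_abs_rpow_gaussianReal (v : NNReal) {q : ℝ} (hq : 0 ≤ q) :
    Integrable (fun x => |x| ^ q) (gaussianReal 0 v) := by
  have := (memLp_id_gaussianReal (μ := 0) (v := v) q.toNNReal).integrable_norm_rpow'
  simpa [hq] using this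

lemma integrable_abs_mul_rpow_gaussianReal (s : ℝ) (v : NNReal) {q : ℝ} (hq : 0 ≤ q) :
    Integrable (fun z => |s * z| ^ q) (gaussianReal 0 v) := by
  have hfactor (z : ℝ) : |s * z| ^ q = |s| ^ q * |z| ^ q := by
    rw [abs_mul, Real.mul_rpow (abs_nonneg _) (abs_nonneg _)]
  simpa only [hfactor] using (integrable_abs_rpow_gaussianReal v hq).const_mul (|s| ^ q)

lemma charFun_map_mul_gaussianReal (s t : ℝ) :
    charFun ((gaussianReal 0 1).map fun z => s * z) t = (Real.exp (-(t * s) ^ 2 / 2) : ℝ) := by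
  rw [charFun_map_mul, charFun_gaussianReal]
  push_cast
  ring_nf

lemma integral_abs_rpow_gaussianReal {p : ℝ} (hp : 0 < p) :
    ∫ z, |z| ^ p ∂(gaussianReal 0 1) = 2 ^ (p / 2) * (Real.Gamma ((p + 1) / 2) / √Real.pi) := by
  rw [integral_gaussianReal_eq_integral_smul one_ne_zero]
  have heven : (fun x : ℝ => gaussianPDFReal 0 1 x • |x| ^ p)
      = fun x => (fun u : ℝ => (√(2 * Real.pi))⁻¹ *
        (u ^ p * Real.exp (-(1 / 2) * u ^ (2 : ℝ)))) |x| := by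
    ext x
    simp only [gaussianPDFReal, smul_eq_mul, Real.rpow_two, sq_abs, sub_zero, NNReal.coe_one,
      mul_one]
    ring_nf
  rw [heven, integral_comp_abs (f := fun u : ℝ => (√(2 * Real.pi))⁻¹ *
      (u ^ p * Real.exp (-(1 / 2) * u ^ (2 : ℝ)))), integral_const_mul,
    integral_rpow_mul_exp_neg_mul_rpow two_pos (by linarith) (by norm_num)]
  have htwo : ((1 / 2 : ℝ)) ^ (-(p + 1) / 2) = 2 ^ (p / 2) * √2 := by
    rw [one_div, Real.inv_rpow zero_le_two, ← Real.rpow_neg zero_le_two, Real.sqrt_eq_rpow,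
      ← Real.rpow_add two_pos]
    congr 1
    ring
  rw [htwo, Real.sqrt_mul zero_le_two]
  have hpi := Real.sqrt_pos.2 Real.pi_pos
  field_simp

lemma integral_abs_mul_rpow_gaussianReal {s p : ℝ} (hs : 0 ≤ s) (hp : 0 < p) :
    (∫ z, |s * z| ^ p ∂(gaussianReal 0 1)) ^ (1 / p)
      = √2 * s * (Real.Gamma ((p + 1) / 2) / √Real.pi) ^ (1 / p) := by
  have hfactor (z : ℝ) : |s * z| ^ p = s ^ p * |z| ^ p := by
    rw [abs_mul, abs_of_nonneg hs, Real.mul_rpow hs (abs_nonneg _)]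
  have hGamma : 0 ≤ Real.Gamma ((p + 1) / 2) / √Real.pi :=
    div_nonneg (Real.Gamma_pos_of_pos (by positivity)).le (Real.sqrt_nonneg _)
  have hhalf : p / 2 * (1 / p) = 1 / 2 := by field_simp
  simp_rw [hfactor]
  rw [integral_const_mul, integral_abs_rpow_gaussianReal hp,
    Real.mul_rpow (by positivity) (by positivity), Real.mul_rpow (by positivity) hGamma,
    ← Real.rpow_mul hs, ← Real.rpow_mul zero_le_two, mul_one_div_cancel hp.ne', Real.rpow_one,
    hhalf, ← Real.sqrt_eq_rpow]
  ring

lemma tendsto_integral_abs_rpow_of_tendsto_charFun {E : ℕ → Type*} [∀ N, MeasurableSpace (E N)]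
    {μ : ∀ N, Measure (E N)} [∀ N, IsProbabilityMeasure (μ N)] {Z : ∀ N, E N → ℝ}
    (hZm : ∀ N, Measurable (Z N)) (hZ : UnifExpMoments μ Z) {s : ℝ}
    (hchar : ∀ t : ℝ, Tendsto (fun N => ∫ x, Complex.exp ((t * Z N x : ℝ) * Complex.I) ∂(μ N)) atTop
      (𝓝 (Real.exp (-(t * s) ^ 2 / 2) : ℝ))) {p : ℝ} (hp : 0 ≤ p) :
    Tendsto (fun N => ∫ x, |Z N x| ^ p ∂(μ N)) atTop
      (𝓝 (∫ z, |s * z| ^ p ∂(gaussianReal 0 1))) := by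
  have hs : Measurable fun z : ℝ => s * z := by fun_prop
  let law (N : ℕ) : ProbabilityMeasure ℝ :=
    ⟨(μ N).map (Z N), Measure.isProbabilityMeasure_map (hZm N).aemeasurable⟩
  let gaussian : ProbabilityMeasure ℝ :=
    ⟨(gaussianReal 0 1).map fun z => s * z, Measure.isProbabilityMeasure_map hs.aemeasurable⟩
  have hlaw : Tendsto law atTop (𝓝 gaussian) := by
    refine ProbabilityMeasure.tendsto_of_tendsto_charFun fun t => ?_
    change Tendsto (fun N => charFun ((μ N).map (Z N)) t) atTop
      (𝓝 (charFun ((gaussianReal 0 1).map fun z => s * z) t))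
    rw [charFun_map_mul_gaussianReal]
    refine (hchar t).congr fun N => ?_
    rw [charFun_apply_real, integral_map (hZm N).aemeasurable (by fun_prop)]
    simp only [Complex.ofReal_mul]
  have hpow (q : ℝ) : Measurable fun x : ℝ => |x| ^ q := by fun_prop
  have hintegral (N : ℕ) (q : ℝ) : ∫ x, |x| ^ q ∂(law N : Measure ℝ) = ∫ x, |Z N x| ^ q ∂(μ N) :=
    integral_map (hZm N).aemeasurable (hpow q).aestronglyMeasurable
  obtain ⟨K, hK⟩ := hZ.exists_forall_integral_abs_rpow_le hZm (q := 2 * p) (by positivity)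
  have hint₀ : Integrable (fun x => |x| ^ (2 * p)) (gaussian : Measure ℝ) :=
    (integrable_map_measure (hpow _).aestronglyMeasurable hs.aemeasurable).2
      (integrable_abs_mul_rpow_gaussianReal s 1 (by positivity))
  have hmoments := tendsto_integral_abs_rpow_of_bounded hlaw hp (fun N =>
    (integrable_map_measure (hpow _).aestronglyMeasurable (hZm N).aemeasurable).2 (hK N).1)
    (fun N => (hintegral N _).trans_le (hK N).2) hint₀
  simp only [hintegral] at hmoments
  convert hmoments using 2
  exact (integral_map hs.aemeasurable (hpow p).aestronglyMeasurable).symm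

end Moments

namespace HMM

variable {X Y : Type*} [MeasurableSpace X] [MeasurableSpace Y] (M : HMM X Y)

lemma measurable_g_left (y : Y) : Measurable fun x => M.g x y :=
  M.measurable_g.comp (measurable_id.prodMk measurable_const)

lemma bddMeas_g {y : Y} (hb : ∃ B, ∀ x, M.g x y ≤ B) : BddMeas fun x => M.g x y := by
  obtain ⟨B, hB⟩ := hb
  refine ⟨M.measurable_g_left y, B, fun x => ?_⟩
  rw [abs_of_nonneg (M.g_nonneg x y)]
  exact hB x

lemma step_apply (y : Y) (x : X) : M.step y x = ENNReal.ofReal (M.g x y) • M.Q x := by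
  have hmeas : Measurable fun q : X × X => ENNReal.ofReal (M.g q.1 y) :=
    ((M.measurable_g_left y).comp measurable_fst).ennreal_ofReal
  rw [step, Kernel.withDensity_apply _ hmeas, withDensity_const]

lemma integral_step (y : Y) (x : X) (f : X → ℝ) :
    ∫ z, f z ∂(M.step y x) = M.g x y * ∫ z, f z ∂(M.Q x) := by
  rw [step_apply, integral_smul_measure, ENNReal.toReal_ofReal (M.g_nonneg x y), smul_eq_mul]

lemma isFiniteKernel_step {y : Y} (hb : ∃ B, ∀ x, M.g x y ≤ B) : IsFiniteKernel (M.step y) := by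
  obtain ⟨B, hB⟩ := hb
  refine ⟨⟨ENNReal.ofReal B, ENNReal.ofReal_lt_top, fun x => ?_⟩⟩
  rw [step_apply, Measure.smul_apply, measure_univ, smul_eq_mul, mul_one]
  exact ENNReal.ofReal_le_ofReal (hB x)

section Predictor

variable {y : ℕ → Y} (hb : ∀ k, ∃ B, ∀ x, M.g x (y k) ≤ B) (hg : ∀ x y, 0 < M.g x y)

include hb in
lemma isFiniteKernel_L (k m : ℕ) : IsFiniteKernel (M.L y k m) := by
  induction m with
  | zero => rw [L]; infer_instance
  | succ m ih =>
    have := M.isFiniteKernel_step (hb (k + m))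
    rw [L]; infer_instance

lemma integral_L_zero (k : ℕ) (x : X) {f : X → ℝ} (hf : Measurable f) :
    ∫ z, f z ∂(M.L y k 0 x) = f x := by
  rw [L, Kernel.id_apply, integral_dirac' _ _ hf.stronglyMeasurable]

include hb in
lemma integral_L_succ (k m : ℕ) (x : X) {f : X → ℝ} (hf : BddMeas f) :
    ∫ z, f z ∂(M.L y k (m + 1) x)
      = ∫ z, M.g z (y (k + m)) * ∫ w, f w ∂(M.Q z) ∂(M.L y k m x) := by
  have := M.isFiniteKernel_L hb k (m + 1)
  have hint := hf.integrable (M.L y k (m + 1) x)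
  rw [L] at hint ⊢
  simp_rw [Kernel.integral_comp hint, integral_step]

include hb in
lemma integral_one_L_succ (k m : ℕ) (x : X) :
    ∫ _z, (1 : ℝ) ∂(M.L y k (m + 1) x) = ∫ z, M.g z (y (k + m)) ∂(M.L y k m x) := by
  rw [M.integral_L_succ hb k m x (BddMeas.const 1)]
  simp

variable (χ : Measure X)

lemma L_comp_succ (n : ℕ) : M.L y 0 (n + 1) ∘ₘ χ = M.step (y n) ∘ₘ (M.L y 0 n ∘ₘ χ) := by
  rw [Measure.comp_assoc, L, zero_add]

lemma integral_predictor (n : ℕ) (f : X → ℝ) :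
    ∫ x, f x ∂(M.predictor χ y n)
      = (∫ x, f x ∂(M.L y 0 n ∘ₘ χ)) / ∫ _x, (1 : ℝ) ∂(M.L y 0 n ∘ₘ χ) := by
  rw [predictor, integral_smul_measure, smul_eq_mul, ENNReal.toReal_inv, integral_const,
    smul_eq_mul, mul_one, measureReal_def, div_eq_inv_mul]

include hb in
lemma integral_L_comp_succ [IsFiniteMeasure χ] (n : ℕ) {f : X → ℝ} (hf : BddMeas f) :
    ∫ x, f x ∂(M.L y 0 (n + 1) ∘ₘ χ)
      = ∫ x, M.g x (y n) * ∫ z, f z ∂(M.Q x) ∂(M.L y 0 n ∘ₘ χ) := by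
  have := M.isFiniteKernel_L hb 0 (n + 1)
  have hint := hf.integrable (M.L y 0 (n + 1) ∘ₘ χ)
  rw [L_comp_succ] at hint ⊢
  simp_rw [integral_comp_measure hint, integral_step]

include hb in
lemma integral_one_L_comp_succ [IsFiniteMeasure χ] (n : ℕ) :
    ∫ _x, (1 : ℝ) ∂(M.L y 0 (n + 1) ∘ₘ χ) = ∫ x, M.g x (y n) ∂(M.L y 0 n ∘ₘ χ) := by
  rw [M.integral_L_comp_succ hb χ n (BddMeas.const 1)]
  simp

variable [IsProbabilityMeasure χ]

lemma predictor_zero : M.predictor χ y 0 = χ := by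
  simp [predictor, L]

include hg in
lemma L_comp_univ_ne_zero (n : ℕ) : (M.L y 0 n ∘ₘ χ) Set.univ ≠ 0 := by
  induction n with
  | zero => simp [L]
  | succ n ih =>
    have hsupport : Function.support (fun x => ENNReal.ofReal (M.g x (y n))) = Set.univ := by
      ext x
      simp [hg x (y n)]
    rw [L_comp_succ, Measure.bind_apply MeasurableSet.univ (Kernel.aemeasurable _)]
    simp only [step_apply, Measure.smul_apply, measure_univ, smul_eq_mul, mul_one]
    rw [← pos_iff_ne_zero, lintegral_pos_iff_support (M.measurable_g_left (y n)).ennreal_ofReal,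
      hsupport]
    exact pos_iff_ne_zero.2 ih

include hb hg

lemma isProbabilityMeasure_predictor (n : ℕ) : IsProbabilityMeasure (M.predictor χ y n) := by
  have := M.isFiniteKernel_L hb 0 n
  constructor
  rw [predictor, Measure.smul_apply, smul_eq_mul,
    ENNReal.inv_mul_cancel (M.L_comp_univ_ne_zero hg χ n) (measure_ne_top _ _)]

lemma integral_one_L_comp_pos (n : ℕ) : 0 < ∫ _x, (1 : ℝ) ∂(M.L y 0 n ∘ₘ χ) := by
  have := M.isFiniteKernel_L hb 0 n
  rw [integral_const, smul_eq_mul, mul_one]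
  exact ENNReal.toReal_pos (M.L_comp_univ_ne_zero hg χ n) (measure_ne_top _ _)

lemma integral_g_predictor_pos (n : ℕ) : 0 < ∫ x, M.g x (y n) ∂(M.predictor χ y n) := by
  rw [M.integral_predictor χ, ← M.integral_one_L_comp_succ hb χ n]
  exact div_pos (M.integral_one_L_comp_pos hb hg χ (n + 1)) (M.integral_one_L_comp_pos hb hg χ n)

lemma integral_predictor_succ (n : ℕ) {f : X → ℝ} (hf : BddMeas f) :
    ∫ x, f x ∂(M.predictor χ y (n + 1))
      = (∫ x, M.g x (y n) * ∫ z, f z ∂(M.Q x) ∂(M.predictor χ y n))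
        / ∫ x, M.g x (y n) ∂(M.predictor χ y n) := by
  rw [M.integral_predictor χ (n + 1), M.integral_predictor χ n, M.integral_predictor χ n,
    M.integral_L_comp_succ hb χ n hf, M.integral_one_L_comp_succ hb χ n,
    div_div_div_cancel_right₀ (M.integral_one_L_comp_pos hb hg χ n).ne']

lemma integral_predictor_mul_integral_L_one (k m : ℕ) {f : X → ℝ} (hf : BddMeas f) :
    (∫ x, f x ∂(M.predictor χ y (k + m))) *
        ∫ x, (∫ _z, (1 : ℝ) ∂(M.L y k m x)) ∂(M.predictor χ y k)
      = ∫ x, (∫ z, f z ∂(M.L y k m x)) ∂(M.predictor χ y k) := by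
  have := M.isProbabilityMeasure_predictor hb hg χ
  induction m generalizing f with
  | zero =>
    simp_rw [M.integral_L_zero k _ hf.measurable, M.integral_L_zero k _ measurable_const]
    simp
  | succ m ih =>
    have hgb := M.bddMeas_g (hb (k + m))
    simp_rw [M.integral_L_succ hb k m _ hf, M.integral_one_L_succ hb k m]
    rw [← ih (hgb.mul (hf.kernel_integral M.Q)), ← ih hgb, ← add_assoc,
      M.integral_predictor_succ hb hg χ (k + m) hf]
    field_simp [(M.integral_g_predictor_pos hb hg χ (k + m)).ne']

omit hb hg [IsProbabilityMeasure χ]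

/-- The test function through which the fluctuations of the particles at time `n` contribute to
those of `h` at time `n + 1`. -/
def pullback (χ : Measure X) (y : ℕ → Y) (n : ℕ) (h : X → ℝ) (x : X) : ℝ :=
  M.g x (y n) * (∫ z, h z ∂(M.Q x) - ∫ z, h z ∂(M.predictor χ y (n + 1)))
    / ∫ z, M.g z (y n) ∂(M.predictor χ y n)

include hb in
lemma bddMeas_pullback (n : ℕ) {h : X → ℝ} (hh : BddMeas h) : BddMeas (M.pullback χ y n h) :=
  ((M.bddMeas_g (hb n)).mul ((hh.kernel_integral M.Q).sub (BddMeas.const _))).div_const _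

include hb in
lemma integral_pullback_eq (n : ℕ) {h : X → ℝ} (hh : BddMeas h) (μ : Measure X)
    [IsFiniteMeasure μ] :
    ∫ x, M.pullback χ y n h x ∂μ
      = (∫ x, M.g x (y n) * ∫ z, h z ∂(M.Q x) ∂μ
          - (∫ z, h z ∂(M.predictor χ y (n + 1))) * ∫ x, M.g x (y n) ∂μ)
        / ∫ x, M.g x (y n) ∂(M.predictor χ y n) := by
  have hgb := M.bddMeas_g (hb n)
  simp only [pullback, integral_div, mul_sub]
  rw [integral_sub ((hgb.mul (hh.kernel_integral M.Q)).integrable μ)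
    ((hgb.mul (BddMeas.const _)).integrable μ), integral_mul_const, mul_comm (∫ z, h z ∂_)]

include hb hg in
lemma integral_pullback_predictor [IsProbabilityMeasure χ] (n : ℕ) {h : X → ℝ} (hh : BddMeas h) :
    ∫ x, M.pullback χ y n h x ∂(M.predictor χ y n) = 0 := by
  have := M.isProbabilityMeasure_predictor hb hg χ n
  rw [M.integral_pullback_eq hb χ n hh, M.integral_predictor_succ hb hg χ n hh,
    div_mul_cancel₀ _ (M.integral_g_predictor_pos hb hg χ n).ne', sub_self, zero_div]

include hb in
lemma integral_pullback_L (k m : ℕ) (x : X) {h : X → ℝ} (hh : BddMeas h) :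
    ∫ z, M.pullback χ y (k + m) h z ∂(M.L y k m x)
      = (∫ z, h z ∂(M.L y k (m + 1) x)
          - (∫ z, h z ∂(M.predictor χ y (k + m + 1))) * ∫ _z, (1 : ℝ) ∂(M.L y k (m + 1) x))
        / ∫ z, M.g z (y (k + m)) ∂(M.predictor χ y (k + m)) := by
  have := M.isFiniteKernel_L hb k m
  rw [M.integral_pullback_eq hb χ (k + m) hh, M.integral_L_succ hb k m x hh,
    M.integral_one_L_succ hb k m x]

lemma asympVar_nonneg (n : ℕ) (h : X → ℝ) : 0 ≤ M.asympVar χ y n h :=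
  Finset.sum_nonneg fun _ _ => integral_nonneg fun _ => sq_nonneg _

lemma asympVar_const_mul (n : ℕ) (h : X → ℝ) (t : ℝ) :
    M.asympVar χ y n (fun z => t * h z) = t ^ 2 * M.asympVar χ y n h := by
  simp only [asympVar, integral_const_mul, Finset.mul_sum]
  refine Finset.sum_congr rfl fun k _ => ?_
  rw [← integral_const_mul (t ^ 2)]
  refine integral_congr_ae (ae_of_all _ fun x => ?_)
  ring

lemma asympVar_last_term (n : ℕ) {h : X → ℝ} (hh : Measurable h)
    [IsProbabilityMeasure (M.predictor χ y n)] :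
    ∫ x, ((∫ z, h z ∂(M.L y n (n - n) x)
            - (∫ z, h z ∂(M.predictor χ y n)) * ∫ _z, (1 : ℝ) ∂(M.L y n (n - n) x))
          / ∫ x', (∫ _z, (1 : ℝ) ∂(M.L y n (n - n) x')) ∂(M.predictor χ y n)) ^ 2
      ∂(M.predictor χ y n)
    = Var[h; M.predictor χ y n] := by
  rw [variance_eq_integral hh.aemeasurable, Nat.sub_self]
  simp_rw [M.integral_L_zero n _ hh, M.integral_L_zero n _ measurable_const]
  simp

variable [IsProbabilityMeasure χ]

lemma asympVar_zero {h : X → ℝ} (hh : Measurable h) : M.asympVar χ y 0 h = Var[h; χ] := by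
  have : IsProbabilityMeasure (M.predictor χ y 0) := by rw [predictor_zero]; infer_instance
  rw [asympVar, Finset.sum_range_one, M.asympVar_last_term χ 0 hh, predictor_zero]

include hb hg in
lemma asympVar_succ (n : ℕ) {h : X → ℝ} (hh : BddMeas h) :
    M.asympVar χ y (n + 1) h =
      M.asympVar χ y n (M.pullback χ y n h) + Var[h; M.predictor χ y (n + 1)] := by
  have := M.isProbabilityMeasure_predictor hb hg χ
  rw [asympVar, Finset.sum_range_succ, M.asympVar_last_term χ (n + 1) hh.measurable, asympVar]
  congr 1
  refine Finset.sum_congr rfl fun k hk => ?_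
  obtain ⟨m, rfl⟩ := Nat.exists_eq_add_of_le (Finset.mem_range_succ_iff.1 hk)
  have hnorm := M.integral_predictor_mul_integral_L_one hb hg χ k m (M.bddMeas_g (hb (k + m)))
  rw [add_assoc, Nat.add_sub_cancel_left, Nat.add_sub_cancel_left,
    M.integral_pullback_predictor hb hg χ (k + m) hh]
  simp_rw [M.integral_pullback_L hb χ k m _ hh, M.integral_one_L_succ hb k m, ← hnorm]
  simp only [zero_mul, sub_zero, div_div, add_assoc]

end Predictor

end HMM

namespace HMM

variable {X Y : Type*} [MeasurableSpace X] [MeasurableSpace Y] (M : HMM X Y)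

lemma sum_g_pos (hg : ∀ x y, 0 < M.g x y) (y : Y) {N : ℕ} [NeZero N] (x : Fin N → X) :
    0 < ∑ l, M.g (x l) y :=
  Finset.sum_pos (fun _ _ => hg _ _) Finset.univ_nonempty

lemma mixture_univ (y : Y) {N : ℕ} (x : Fin N → X) :
    M.mixture y x Set.univ = ENNReal.ofReal ((∑ j, M.g (x j) y) / ∑ l, M.g (x l) y) := by
  simp only [mixture, Measure.coe_finsetSum, Finset.sum_apply, Measure.smul_apply, measure_univ,
    smul_eq_mul, mul_one]
  rw [← ENNReal.ofReal_sum_of_nonneg fun i _ =>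
    div_nonneg (M.g_nonneg _ _) (Finset.sum_nonneg fun l _ => M.g_nonneg _ _), Finset.sum_div]

lemma mixture_univ_le_one (y : Y) {N : ℕ} (x : Fin N → X) : M.mixture y x Set.univ ≤ 1 := by
  rw [mixture_univ]
  exact ENNReal.ofReal_le_one.2 (div_self_le_one _)

instance isFiniteMeasure_mixture (y : Y) {N : ℕ} (x : Fin N → X) :
    IsFiniteMeasure (M.mixture y x) :=
  ⟨(M.mixture_univ_le_one y x).trans_lt ENNReal.one_lt_top⟩

lemma isProbabilityMeasure_mixture (hg : ∀ x y, 0 < M.g x y) (y : Y) {N : ℕ} [NeZero N]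
    (x : Fin N → X) : IsProbabilityMeasure (M.mixture y x) :=
  ⟨by rw [mixture_univ, div_self (M.sum_g_pos hg y x).ne', ENNReal.ofReal_one]⟩

lemma integral_mixture (y : Y) {N : ℕ} (x : Fin N → X) {h : X → ℝ} (hh : BddMeas h) :
    ∫ z, h z ∂(M.mixture y x)
      = (∑ j, M.g (x j) y * ∫ z, h z ∂(M.Q (x j))) / ∑ l, M.g (x l) y := by
  rw [mixture, integral_finsetSum_measure
    fun j _ => (hh.integrable _).smul_measure ENNReal.ofReal_ne_top, Finset.sum_div]
  refine Finset.sum_congr rfl fun j _ => ?_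
  rw [integral_smul_measure, ENNReal.toReal_ofReal (div_nonneg (M.g_nonneg _ _)
    (Finset.sum_nonneg fun l _ => M.g_nonneg _ _)), smul_eq_mul, div_mul_eq_mul_div]

lemma measurable_mixture (N : ℕ) :
    Measurable fun p : Y × (Fin N → X) => M.mixture p.1 p.2 := by
  have hg (j : Fin N) : Measurable fun p : Y × (Fin N → X) => M.g (p.2 j) p.1 :=
    M.measurable_g.comp (by fun_prop : Measurable fun p : Y × (Fin N → X) => (p.2 j, p.1))
  refine Measure.measurable_of_measurable_coe _ fun A hA => ?_
  simp only [mixture, Measure.coe_finsetSum, Finset.sum_apply, Measure.smul_apply, smul_eq_mul]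
  refine Finset.measurable_sum _ fun j _ => Measurable.mul ?_ ?_
  · exact ((hg j).div (Finset.measurable_sum _ fun l _ => hg l)).ennreal_ofReal
  · exact (M.Q.measurable_coe hA).comp (by fun_prop)

lemma measurable_integral_mixture {h : X → ℝ} (hh : Measurable h) (N : ℕ) :
    Measurable fun p : Y × (Fin N → X) => ∫ z, h z ∂(M.mixture p.1 p.2) :=
  let κ : Kernel (Y × (Fin N → X)) X := ⟨_, M.measurable_mixture N⟩
  have : IsFiniteKernel κ := ⟨⟨1, ENNReal.one_lt_top, fun p => M.mixture_univ_le_one p.1 p.2⟩⟩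
  (hh.stronglyMeasurable.integral_kernel (κ := κ)).measurable

/-- One transition of the particle system: given the pair of an observation and the current
particles, the new particles are drawn independently from the mixture. -/
def mutation (N : ℕ) : Kernel (Y × (Fin N → X)) (Fin N → X) where
  toFun p := Measure.pi fun _ => M.mixture p.1 p.2
  measurable' := measurable_pi_const (M.measurable_mixture N)

lemma mutation_apply (N : ℕ) (p : Y × (Fin N → X)) :
    M.mutation N p = Measure.pi fun _ => M.mixture p.1 p.2 := rfl

instance isFiniteKernel_mutation (N : ℕ) : IsFiniteKernel (M.mutation N) :=
  ⟨⟨1, ENNReal.one_lt_top, fun p => pi_const_univ_le_one (M.mixture_univ_le_one p.1 p.2)⟩⟩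

lemma isMarkovKernel_mutation (hg : ∀ x y, 0 < M.g x y) (N : ℕ) [NeZero N] :
    IsMarkovKernel (M.mutation N) where
  isProbabilityMeasure p := by
    have := M.isProbabilityMeasure_mixture hg p.1 p.2
    rw [mutation_apply]
    infer_instance

/-- The transition of the particle system at time `n`, as a kernel from the pair of the whole
observation sequence and the current particles. -/
def transition (N n : ℕ) : Kernel ((ℕ → Y) × (Fin N → X)) (Fin N → X) :=
  (M.mutation N).comap (fun p => (p.1 n, p.2)) (by fun_prop)

instance isFiniteKernel_transition (N n : ℕ) : IsFiniteKernel (M.transition N n) := by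
  rw [transition]; infer_instance

/-- The law of the `N` particles at time `n` given the observation sequence. -/
def particleKernel (χ : Measure X) (N : ℕ) : ℕ → Kernel (ℕ → Y) (Fin N → X)
  | 0 => Kernel.const _ (Measure.pi fun _ => χ)
  | n + 1 => Kernel.snd (particleKernel χ N n ⊗ₖ M.transition N n)

section ParticleKernel

variable (χ : Measure X) [IsFiniteMeasure χ] (N : ℕ)

instance isFiniteKernel_particleKernel (n : ℕ) : IsFiniteKernel (M.particleKernel χ N n) := by
  induction n with
  | zero => rw [particleKernel]; infer_instance
  | succ n ih => rw [particleKernel]; infer_instance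

lemma particleKernel_succ_apply (n : ℕ) (y : ℕ → Y) :
    M.particleKernel χ N (n + 1) y
      = (M.mutation N).sectR (y n) ∘ₘ M.particleKernel χ N n y := by
  ext A hA
  rw [particleKernel, Kernel.snd_apply' _ _ hA, Kernel.compProd_apply (measurable_snd hA),
    Measure.bind_apply hA (Kernel.aemeasurable _)]
  rfl

lemma dependsOn_particleKernel (n : ℕ) :
    DependsOn (fun y => M.particleKernel χ N n y) (Set.Iio n) := by
  induction n with
  | zero => exact fun _ _ _ => rfl
  | succ n ih =>
    intro y y' hy
    have hprev : M.particleKernel χ N n y = M.particleKernel χ N n y' :=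
      ih fun k hk => hy k (Nat.lt_succ_of_lt hk)
    simp only [particleKernel_succ_apply, hprev, hy n (Nat.lt_succ_self n)]

end ParticleKernel

lemma isMarkovKernel_particleKernel (hg : ∀ x y, 0 < M.g x y) (χ : Measure X)
    [IsProbabilityMeasure χ] (N : ℕ) [NeZero N] (n : ℕ) :
    IsMarkovKernel (M.particleKernel χ N n) := by
  induction n with
  | zero => rw [particleKernel]; infer_instance
  | succ n ih =>
    have := M.isMarkovKernel_mutation hg N
    rw [particleKernel, transition]; infer_instance

section PredError

variable {y : ℕ → Y} (hb : ∀ k, ∃ B, ∀ x, M.g x (y k) ≤ B) (hg : ∀ x y, 0 < M.g x y)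
  (χ : Measure X)

/-- The error of the particles `x` in approximating the predictor at time `n`, scaled by the square
root of their number. -/
def predError (y : ℕ → Y) (n : ℕ) (h : X → ℝ) {N : ℕ} (x : Fin N → X) : ℝ :=
  scaledError h (∫ z, h z ∂(M.predictor χ y n)) x

lemma measurable_predError (n : ℕ) {h : X → ℝ} (hh : Measurable h) (N : ℕ) :
    Measurable fun x : Fin N → X => M.predError χ y n h x :=
  measurable_scaledError hh _ N

lemma predError_const_mul (n : ℕ) (t : ℝ) (h : X → ℝ) {N : ℕ} (x : Fin N → X) :
    M.predError χ y n (fun z => t * h z) x = t * M.predError χ y n h x := by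
  simp only [predError, scaledError, empMean, integral_const_mul, ← Finset.mul_sum]
  ring

/-- The likelihood normalized by its mean under the predictor: the density by which the
observation at time `n` reweights the predictor. -/
def normLik (y : ℕ → Y) (n : ℕ) (x : X) : ℝ :=
  M.g x (y n) / ∫ z, M.g z (y n) ∂(M.predictor χ y n)

include hb in
lemma bddMeas_normLik (n : ℕ) : BddMeas (M.normLik χ y n) :=
  (M.bddMeas_g (hb n)).div_const _

include hb hg in
lemma integral_normLik_predictor [IsProbabilityMeasure χ] (n : ℕ) :
    ∫ z, M.normLik χ y n z ∂(M.predictor χ y n) = 1 := by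
  simp only [normLik, integral_div]
  exact div_self (M.integral_g_predictor_pos hb hg χ n).ne'

/-- The bias of the mixture from which the particles at time `n + 1` are drawn, as an approximation
of the predictor at that time. -/
def mixBias (y : ℕ → Y) (n : ℕ) (h : X → ℝ) {N : ℕ} (x : Fin N → X) : ℝ :=
  ∫ z, h z ∂(M.mixture (y n) x) - ∫ z, h z ∂(M.predictor χ y (n + 1))

lemma measurable_mixBias (n : ℕ) {h : X → ℝ} (hh : Measurable h) (N : ℕ) :
    Measurable fun x : Fin N → X => M.mixBias χ y n h x :=
  ((M.measurable_integral_mixture hh N).comp measurable_prodMk_left).sub_const _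

lemma predError_succ (n : ℕ) (h : X → ℝ) {N : ℕ} (x x' : Fin N → X) :
    M.predError χ y (n + 1) h x'
      = scaledError h (∫ z, h z ∂(M.mixture (y n) x)) x' + √(N : ℝ) * M.mixBias χ y n h x := by
  rw [predError, scaledError, scaledError, mixBias]
  ring

include hg in
/-- The mixture is a ratio of two empirical means, so its bias is the empirical mean of a centered
function divided by that of `normLik`. -/
lemma empMean_pullback (n : ℕ) {h : X → ℝ} (hh : BddMeas h) {N : ℕ} [NeZero N] (x : Fin N → X) :
    empMean (M.pullback χ y n h) x = M.mixBias χ y n h x * empMean (M.normLik χ y n) x := by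
  have hsum := (M.sum_g_pos hg (y n) x).ne'
  have hweights : ∑ i, M.g (x i) (y n) *
      (∫ z, h z ∂(M.Q (x i)) - ∫ z, h z ∂(M.predictor χ y (n + 1)))
      = M.mixBias χ y n h x * ∑ i, M.g (x i) (y n) := by
    rw [mixBias, M.integral_mixture _ _ hh]
    simp only [mul_sub, Finset.sum_sub_distrib, ← Finset.sum_mul]
    field_simp
  simp only [empMean, pullback, normLik, ← Finset.sum_div]
  rw [hweights]
  ring

variable [IsProbabilityMeasure χ]

include hb hg

lemma sqrt_mul_mixBias (n : ℕ) {h : X → ℝ} (hh : BddMeas h) {N : ℕ} [NeZero N]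
    (x : Fin N → X) :
    √(N : ℝ) * M.mixBias χ y n h x
      = M.predError χ y n (M.pullback χ y n h) x
        - M.mixBias χ y n h x * M.predError χ y n (M.normLik χ y n) x := by
  rw [predError, predError, M.integral_pullback_predictor hb hg χ n hh,
    M.integral_normLik_predictor hb hg χ, scaledError, scaledError,
    M.empMean_pullback hg χ n hh x]
  ring

lemma abs_mixBias_le (n : ℕ) {h : X → ℝ} {C : ℝ} (hC : ∀ x, |h x| ≤ C)
    {N : ℕ} [NeZero N] (x : Fin N → X) : |M.mixBias χ y n h x| ≤ 2 * C := by
  have := M.isProbabilityMeasure_predictor hb hg χ (n + 1)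
  have := M.isProbabilityMeasure_mixture hg (y n) x
  refine (abs_sub _ _).trans ?_
  linarith [abs_integral_le_of_bound (M.mixture (y n) x) hC,
    abs_integral_le_of_bound (M.predictor χ y (n + 1)) hC]

lemma unifExpMoments_mixBias {n : ℕ} {h : X → ℝ} (hh : BddMeas h)
    (hpred : ∀ {f : X → ℝ}, BddMeas f → UnifExpMoments
      (fun N => M.particleKernel χ (N + 1) n y) fun _ x => M.predError χ y n f x) :
    UnifExpMoments (fun N => M.particleKernel χ (N + 1) n y)
      fun N x => √((N + 1 : ℕ) : ℝ) * M.mixBias χ y n h x := by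
  obtain ⟨C, hC0, hC⟩ := hh.exists_bound
  have hpb := M.bddMeas_pullback hb χ n hh
  have hpull := (hpred hpb).abs
  have hlik := (hpred (M.bddMeas_normLik hb χ n)).abs.const_mul (2 * C)
  refine (hpull.add (fun N => (M.measurable_predError χ n hpb.measurable _).abs) hlik).mono
    fun N x => ?_
  have hbias := M.abs_mixBias_le hb hg χ n hC x
  rw [M.sqrt_mul_mixBias hb hg χ n hh x]
  calc _ ≤ |M.predError χ y n (M.pullback χ y n h) x|
            + |M.mixBias χ y n h x| * |M.predError χ y n (M.normLik χ y n) x| := by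
        rw [← abs_mul]
        exact abs_sub _ _
    _ ≤ _ := by gcongr
    _ ≤ _ := le_abs_self _

theorem unifExpMoments_predError (n : ℕ) {h : X → ℝ} (hh : BddMeas h) :
    UnifExpMoments (fun N => M.particleKernel χ (N + 1) n y) fun _ x => M.predError χ y n h x := by
  induction n generalizing h with
  | zero =>
    intro t _
    obtain ⟨K, hK⟩ := exists_forall_lintegral_exp_mul_abs_scaledError_le hh t
    simp only [predError, predictor_zero]
    exact ⟨K, fun N => hK χ (N + 1)⟩
  | succ n ih =>
    simp_rw [particleKernel_succ_apply]
    refine (M.unifExpMoments_mixBias hb hg χ hh ih).comp_kernel _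
      (fun N => M.measurable_predError χ (n + 1) hh.measurable _) fun t ht => ?_
    obtain ⟨K, hK⟩ := exists_forall_lintegral_exp_mul_abs_scaledError_le hh t
    refine ⟨K, fun N x => ?_⟩
    have := M.isProbabilityMeasure_mixture hg (y n) x
    refine le_trans ?_ (mul_le_mul_left (hK (M.mixture (y n) x) (N + 1)) _)
    rw [← lintegral_mul_const' _ _ ENNReal.ofReal_ne_top]
    refine lintegral_mono fun x' => ?_
    rw [← ENNReal.ofReal_mul (Real.exp_pos _).le, ← Real.exp_add, ← mul_add,
      M.predError_succ χ n h x x']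
    have := abs_add_le (scaledError h (∫ z, h z ∂(M.mixture (y n) x)) x')
      (√((N + 1 : ℕ) : ℝ) * M.mixBias χ y n h x)
    gcongr

end PredError

end HMM

namespace HMM

open Complex

variable {X Y : Type*} [MeasurableSpace X] [MeasurableSpace Y] (M : HMM X Y)
  {y : ℕ → Y} (hb : ∀ k, ∃ B, ∀ x, M.g x (y k) ≤ B) (hg : ∀ x y, 0 < M.g x y)
  (χ : Measure X) [IsProbabilityMeasure χ]

include hb hg

lemma variance_mixture_sub_variance_predictor (n : ℕ) {h : X → ℝ} (hh : BddMeas h) {N : ℕ}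
    [NeZero N] (x : Fin N → X) :
    Var[h; M.mixture (y n) x] - Var[h; M.predictor χ y (n + 1)]
      = M.mixBias χ y n (fun z => h z ^ 2) x - M.mixBias χ y n h x
          * (∫ z, h z ∂(M.mixture (y n) x) + ∫ z, h z ∂(M.predictor χ y (n + 1))) := by
  have := M.isProbabilityMeasure_predictor hb hg χ (n + 1)
  have := M.isProbabilityMeasure_mixture hg (y n) x
  rw [variance_eq_sub (hh.memLp _ 2), variance_eq_sub (hh.memLp _ 2), mixBias, mixBias]
  simp only [Pi.pow_apply]
  ring

lemma abs_variance_mixture_sub_le (n : ℕ) {h : X → ℝ} (hh : BddMeas h) {C : ℝ}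
    (hC : ∀ x, |h x| ≤ C) {N : ℕ} [NeZero N] (x : Fin N → X) :
    |Var[h; M.mixture (y n) x] - Var[h; M.predictor χ y (n + 1)]|
      ≤ |M.mixBias χ y n (fun z => h z ^ 2) x| + |M.mixBias χ y n h x| * (2 * C) := by
  have := M.isProbabilityMeasure_predictor hb hg χ (n + 1)
  have := M.isProbabilityMeasure_mixture hg (y n) x
  rw [M.variance_mixture_sub_variance_predictor hb hg χ n hh x]
  refine (abs_sub _ _).trans ?_
  rw [abs_mul]
  gcongr
  refine (abs_add_le _ _).trans ?_
  linarith [abs_integral_le_of_bound (M.mixture (y n) x) hC,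
    abs_integral_le_of_bound (M.predictor χ y (n + 1)) hC]

omit hb hg [IsProbabilityMeasure χ] in
lemma integral_cexp_predError_mutation (n : ℕ) (h : X → ℝ) {N : ℕ} (x : Fin N → X) :
    ∫ x', cexp (M.predError χ y (n + 1) h x' * I) ∂(M.mutation N (y n, x))
      = cexp ((√(N : ℝ) * M.mixBias χ y n h x : ℝ) * I)
        * ∫ x', cexp (scaledError h (∫ z, h z ∂(M.mixture (y n) x)) x' * I)
            ∂(M.mutation N (y n, x)) := by
  rw [← integral_const_mul]
  refine integral_congr_ae (ae_of_all _ fun x' => ?_)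
  beta_reduce
  rw [M.predError_succ χ n h x x', ← Complex.exp_add]
  congr 1
  push_cast
  ring

/-- Given the particles at time `n`, the new error is the sum of a conditionally centered
fluctuation, asymptotically normal with the variance of `h` under the predictor, and of a bias that
is the error of `pullback` up to a product of two errors. -/
lemma exists_norm_integral_cexp_mutation_sub_le (n : ℕ) {h : X → ℝ} (hh : BddMeas h) :
    ∃ D, 0 ≤ D ∧ ∀ (N : ℕ) [NeZero N] (x : Fin N → X),
      ‖∫ x', cexp (M.predError χ y (n + 1) h x' * I) ∂(M.mutation N (y n, x))
          - cexp (M.predError χ y n (M.pullback χ y n h) x * I)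
            * Real.exp (-Var[h; M.predictor χ y (n + 1)] / 2)‖
        ≤ (D + (√(N : ℝ) * M.mixBias χ y n (fun z => h z ^ 2) x) ^ 2
            + 2 * (√(N : ℝ) * M.mixBias χ y n h x) ^ 2
            + M.predError χ y n (M.normLik χ y n) x ^ 2) / √(N : ℝ) := by
  obtain ⟨C, hC0, hC⟩ := hh.exists_bound
  obtain ⟨D, hD0, hD⟩ := exists_norm_integral_cexp_scaledError_sub_le hh
  refine ⟨D + 1 + C ^ 2, by positivity, fun N _ x => ?_⟩
  have := M.isProbabilityMeasure_mixture hg (y n) x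
  have hN : 0 < √(N : ℝ) := Real.sqrt_pos.2 (by exact_mod_cast NeZero.pos N)
  have hvar := M.abs_variance_mixture_sub_le hb hg χ n hh hC x
  have hclt := norm_cexp_mul_sub_le (a := √(N : ℝ) * M.mixBias χ y n h x)
    (b := M.predError χ y n (M.pullback χ y n h) x) (variance_nonneg h (M.mixture (y n) x))
    (variance_nonneg h (M.predictor χ y (n + 1))) (hD (M.mixture (y n) x) N)
  have hbias := M.sqrt_mul_mixBias hb hg χ n hh x
  rw [M.integral_cexp_predError_mutation χ n h x]
  refine hclt.trans ?_
  generalize √(N : ℝ) = s, M.mixBias χ y n h x = r, M.mixBias χ y n (fun z => h z ^ 2) x = r₂,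
    M.predError χ y n (M.pullback χ y n h) x = a, M.predError χ y n (M.normLik χ y n) x = b
    at hN hvar hbias ⊢
  rw [hbias, sub_sub_cancel_left, abs_neg, abs_mul, ← hbias, le_div_iff₀ hN, add_mul, add_mul,
    div_mul_cancel₀ _ hN.ne']
  have hvar_scaled := mul_le_mul_of_nonneg_right hvar hN.le
  have hsr : |s * r| = |r| * s := by rw [abs_mul, abs_of_pos hN, mul_comm]
  have hsr₂ : |s * r₂| = |r₂| * s := by rw [abs_mul, abs_of_pos hN, mul_comm]
  have hsq_r := two_mul_le_add_sq C |s * r|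
  have hsq_r₂ := two_mul_le_add_sq 1 |s * r₂|
  have hsq_rb := two_mul_le_add_sq |s * r| |b|
  rw [sq_abs, hsr] at hsq_r
  rw [sq_abs, hsr₂] at hsq_r₂
  rw [sq_abs, sq_abs, hsr] at hsq_rb
  linarith [sq_nonneg C, sq_nonneg (s * r), sq_nonneg (s * r₂), sq_nonneg b]

lemma exists_norm_integral_cexp_predError_succ_sub_le (n : ℕ) {h : X → ℝ} (hh : BddMeas h) :
    ∃ K, ∀ N : ℕ,
      ‖∫ x, cexp (M.predError χ y (n + 1) h x * I) ∂(M.particleKernel χ (N + 1) (n + 1) y)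
          - (∫ x, cexp (M.predError χ y n (M.pullback χ y n h) x * I)
              ∂(M.particleKernel χ (N + 1) n y))
            * Real.exp (-Var[h; M.predictor χ y (n + 1)] / 2)‖ ≤ K / √((N + 1 : ℕ) : ℝ) := by
  have hsq : BddMeas fun z => h z ^ 2 := by simpa only [pow_two] using hh.mul hh
  have hlik := M.bddMeas_normLik hb χ n
  have hbias {f : X → ℝ} (hf : BddMeas f) :=
    (M.unifExpMoments_mixBias hb hg χ hf (M.unifExpMoments_predError hb hg χ n)
      ).exists_forall_integral_sq_le fun _ =>
        (M.measurable_mixBias χ n hf.measurable _).const_mul _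
  obtain ⟨D, hD0, hD⟩ := M.exists_norm_integral_cexp_mutation_sub_le hb hg χ n hh
  obtain ⟨K₁, hK₁⟩ := hbias hsq
  obtain ⟨K₂, hK₂⟩ := hbias hh
  obtain ⟨K₃, hK₃⟩ := (M.unifExpMoments_predError hb hg χ n hlik).exists_forall_integral_sq_le
    fun _ => M.measurable_predError χ n hlik.measurable _
  refine ⟨D + K₁ + 2 * K₂ + K₃, fun N => ?_⟩
  have := M.isMarkovKernel_mutation hg (N + 1)
  have := M.isMarkovKernel_particleKernel hg χ (N + 1)
  have hcexp (k : ℕ) {f : X → ℝ} (hf : BddMeas f) (μ : Measure (Fin (N + 1) → X))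
      [IsFiniteMeasure μ] : Integrable (fun x => cexp (M.predError χ y k f x * I)) μ :=
    integrable_cexp_mul_I (M.measurable_predError χ k hf.measurable _) μ
  have hint := hcexp (n + 1) hh (M.particleKernel χ (N + 1) (n + 1) y)
  rw [particleKernel_succ_apply] at hint ⊢
  rw [integral_comp_measure hint, ← integral_mul_const, ← integral_sub hint.integral_comp
    ((hcexp n (M.bddMeas_pullback hb χ n hh) _).mul_const _)]
  have hint₁ : Integrable (fun x => D + (√((N + 1 : ℕ) : ℝ) *
      M.mixBias χ y n (fun z => h z ^ 2) x) ^ 2) (M.particleKernel χ (N + 1) n y) :=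
    (integrable_const D).add (hK₁ N).1
  have hint₂ := (hK₂ N).1.const_mul 2
  refine (norm_integral_le_of_norm_le (((hint₁.add hint₂).add (hK₃ N).1).div_const _)
    (ae_of_all _ fun x => hD _ x)).trans ?_
  rw [integral_div, integral_add' (hint₁.add hint₂) (hK₃ N).1, integral_add' hint₁ hint₂,
    integral_add (integrable_const D) (hK₁ N).1, integral_const_mul]
  simp only [integral_const, probReal_univ, one_smul]
  gcongr
  exacts [(hK₁ N).2, (hK₂ N).2, (hK₃ N).2]

theorem tendsto_integral_cexp_predError (n : ℕ) {h : X → ℝ} (hh : BddMeas h) :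
    Tendsto (fun N : ℕ => ∫ x, cexp (M.predError χ y n h x * I)
        ∂(M.particleKernel χ (N + 1) n y)) atTop
      (𝓝 (Real.exp (-M.asympVar χ y n h / 2) : ℝ)) := by
  have hrate (K : ℝ) : Tendsto (fun N : ℕ => K / √((N + 1 : ℕ) : ℝ)) atTop (𝓝 0) :=
    ((Real.tendsto_sqrt_atTop.comp tendsto_natCast_atTop_atTop).comp
      (tendsto_add_atTop_nat 1)).const_div_atTop K
  induction n generalizing h with
  | zero =>
    obtain ⟨D, -, hD⟩ := exists_norm_integral_cexp_scaledError_sub_le hh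
    rw [tendsto_iff_norm_sub_tendsto_zero, M.asympVar_zero χ hh.measurable]
    simp only [predError, predictor_zero]
    exact squeeze_zero (fun _ => norm_nonneg _) (fun N => hD χ (N + 1)) (hrate D)
  | succ n ih =>
    obtain ⟨K, hK⟩ := M.exists_norm_integral_cexp_predError_succ_sub_le hb hg χ n hh
    have hlim := (squeeze_zero_norm hK (hrate K)).add ((ih (M.bddMeas_pullback hb χ n hh)).mul_const
      ((Real.exp (-Var[h; M.predictor χ y (n + 1)] / 2) : ℝ) : ℂ))
    simp only [sub_add_cancel, zero_add] at hlim
    rwa [M.asympVar_succ hb hg χ n hh, neg_add, add_div, Real.exp_add, Complex.ofReal_mul]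

theorem tendsto_integral_abs_predError_rpow (n : ℕ) {h : X → ℝ} (hh : BddMeas h) {p : ℝ}
    (hp : 0 ≤ p) :
    Tendsto (fun N : ℕ => ∫ x, |M.predError χ y n h x| ^ p ∂(M.particleKernel χ (N + 1) n y)) atTop
      (𝓝 (∫ z, |M.asympStd χ y n h * z| ^ p ∂(gaussianReal 0 1))) := by
  have (N : ℕ) := M.isMarkovKernel_particleKernel hg χ (N + 1)
  refine tendsto_integral_abs_rpow_of_tendsto_charFun
    (fun N => M.measurable_predError χ n hh.measurable (N + 1))
    (M.unifExpMoments_predError hb hg χ n hh) (fun t => ?_) hp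
  have hlim := M.tendsto_integral_cexp_predError hb hg χ n ((BddMeas.const t).mul hh)
  simp_rw [predError_const_mul, asympVar_const_mul] at hlim
  rwa [asympStd, mul_pow, Real.sq_sqrt (M.asympVar_nonneg χ n h)]

theorem tendsto_sqrt_mul_integral_rpow (n : ℕ) {h : X → ℝ} (hh : BddMeas h) {p : ℝ}
    (hp : 0 < p) :
    Tendsto (fun N : ℕ => √((N + 1 : ℕ) : ℝ) *
        (∫ x, |empMean h x - ∫ z, h z ∂(M.predictor χ y n)| ^ p
          ∂(M.particleKernel χ (N + 1) n y)) ^ (1 / p)) atTop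
      (𝓝 (√2 * M.asympStd χ y n h * (Real.Gamma ((p + 1) / 2) / √Real.pi) ^ (1 / p))) := by
  have hscale {N : ℕ} (x : Fin (N + 1) → X) : |M.predError χ y n h x| ^ p
      = √((N + 1 : ℕ) : ℝ) ^ p * |empMean h x - ∫ z, h z ∂(M.predictor χ y n)| ^ p := by
    rw [predError, scaledError, abs_mul, abs_of_nonneg (Real.sqrt_nonneg _),
      Real.mul_rpow (Real.sqrt_nonneg _) (abs_nonneg _)]
  rw [← integral_abs_mul_rpow_gaussianReal (s := M.asympStd χ y n h) (Real.sqrt_nonneg _) hp]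
  refine ((M.tendsto_integral_abs_predError_rpow hb hg χ n hh hp.le).rpow_const
    (Or.inr (by positivity))).congr fun N => ?_
  simp_rw [hscale]
  rw [integral_const_mul, Real.mul_rpow (by positivity)
    (integral_nonneg fun x => Real.rpow_nonneg (abs_nonneg _) _),
    ← Real.rpow_mul (Real.sqrt_nonneg _), mul_one_div_cancel hp.ne', Real.rpow_one]

end HMM

section ConditionalLaw

variable {Ω 𝓧 𝓨 𝓩 : Type*} [MeasurableSpace 𝓧] [MeasurableSpace 𝓨] [MeasurableSpace 𝓩]
  {m₀ : MeasurableSpace Ω} {P : Measure Ω} {Z : Ω → 𝓧} {W : Ω → 𝓨} {κ : Kernel 𝓧 𝓨}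

lemma hasCondDistrib_prodMk {V : Ω → 𝓩} {η : Kernel (𝓧 × 𝓨) 𝓩} (hW : HasCondDistrib W Z κ P)
    (hV : HasCondDistrib V (fun ω => (Z ω, W ω)) η P) :
    HasCondDistrib (fun ω => (W ω, V ω)) Z (κ ⊗ₖ η) P where
  aemeasurable := hW.aemeasurable_fst.prodMk (hW.aemeasurable_snd.prodMk hV.aemeasurable_snd)
  map_eq := by
    rw [← Measure.compProd_assoc', ← hW.map_eq, ← hV.map_eq,
      AEMeasurable.map_map_of_aemeasurable (by fun_prop) hV.aemeasurable]
    rfl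

lemma hasCondDistrib_of_condExp_piSystem [IsFiniteMeasure P] [IsFiniteKernel κ]
    (hZ : Measurable Z) (hW : Measurable W) {C : Set (Set 𝓨)}
    (hgen : ‹MeasurableSpace 𝓨› = MeasurableSpace.generateFrom C) (hC : IsPiSystem C)
    (huniv : Set.univ ∈ C)
    (hcond : ∀ S ∈ C, P⟦W ⁻¹' S | MeasurableSpace.comap Z inferInstance⟧
      =ᵐ[P] fun ω => (κ (Z ω)).real S) :
    HasCondDistrib W Z κ P where
  aemeasurable := (hZ.prodMk hW).aemeasurable
  map_eq := by
    have hmeas {S} (hS : S ∈ C) : MeasurableSet S :=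
      hgen ▸ MeasurableSpace.measurableSet_generateFrom hS
    have hrect : ∀ B, MeasurableSet B → ∀ S ∈ C,
        P.map (fun ω => (Z ω, W ω)) (B ×ˢ S) = (P.map Z ⊗ₘ κ) (B ×ˢ S) := by
      intro B hB S hS
      have hreal : Measurable fun z => (κ z).real S := (κ.measurable_coe (hmeas hS)).ennreal_toReal
      rw [← measureReal_eq_measureReal_iff]
      calc (P.map fun ω => (Z ω, W ω)).real (B ×ˢ S) = P.real (W ⁻¹' S ∩ Z ⁻¹' B) := by
            rw [map_measureReal_apply (hZ.prodMk hW) (hB.prod (hmeas hS)), Set.inter_comm]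
            rfl
        _ = ∫ ω in Z ⁻¹' B, (κ (Z ω)).real S ∂P := by
            rw [← setIntegral_congr_ae (hZ hB) ((hcond S hS).mono fun ω hω _ => hω),
              setIntegral_condExp hZ.comap_le
                ((integrable_const _).indicator (hW (hmeas hS))) ⟨B, hB, rfl⟩,
              setIntegral_indicator (hW (hmeas hS)), Set.inter_comm]
            simp
        _ = ∫ z in B, (κ z).real S ∂(P.map Z) :=
            (setIntegral_map hB hreal.aestronglyMeasurable hZ.aemeasurable).symm
        _ = (P.map Z ⊗ₘ κ).real (B ×ˢ S) := by
            rw [measureReal_def, Measure.compProd_apply_prod hB (hmeas hS)]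
            exact integral_toReal (κ.measurable_coe (hmeas hS)).aemeasurable
              (ae_of_all _ fun _ => measure_lt_top _ _)
    refine ext_of_generate_finite _ (generateFrom_eq_prod
      MeasurableSpace.generateFrom_measurableSet hgen.symm isCountablySpanning_measurableSet
      ⟨fun _ => Set.univ, fun _ => huniv, Set.iUnion_const _⟩).symm
      (MeasurableSpace.isPiSystem_measurableSet.prod hC) ?_ ?_
    · rintro _ ⟨B, hB, S, hS, rfl⟩
      exact hrect B hB S hS
    · simpa using hrect _ MeasurableSet.univ _ huniv

lemma hasCondDistrib_of_condExp_box {ι : Type*} [Finite ι] [IsFiniteMeasure P] {W : Ω → ι → 𝓨}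
    {κ : Kernel 𝓧 (ι → 𝓨)} [IsFiniteKernel κ] (hZ : Measurable Z) (hW : ∀ i, Measurable (W · i))
    (hcond : ∀ A : ι → Set 𝓨, (∀ i, MeasurableSet (A i)) →
      P⟦{ω | ∀ i, W ω i ∈ A i} | MeasurableSpace.comap Z inferInstance⟧
        =ᵐ[P] fun ω => (κ (Z ω)).real (Set.univ.pi A)) :
    HasCondDistrib W Z κ P := by
  refine hasCondDistrib_of_condExp_piSystem hZ (measurable_pi_lambda _ hW) generateFrom_pi.symm
    isPiSystem_pi ⟨fun _ => Set.univ, fun _ _ => MeasurableSet.univ, Set.pi_univ _⟩ ?_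
  rintro _ ⟨A, hA, rfl⟩
  have hbox : W ⁻¹' Set.univ.pi A = {ω | ∀ i, W ω i ∈ A i} := by
    ext ω
    simp
  rw [hbox]
  exact hcond A fun i => hA i (Set.mem_univ i)

section CondExp

variable {f : 𝓧 × 𝓨 → ℝ}

lemma integrable_compProd_of_hasCondDistrib (hW : HasCondDistrib W Z κ P)
    (hf : StronglyMeasurable f) (hint : Integrable (fun ω => f (Z ω, W ω)) P) :
    Integrable f (P.map Z ⊗ₘ κ) := by
  rw [← hW.map_eq]
  exact (integrable_map_measure hf.aestronglyMeasurable hW.aemeasurable).2 hint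

variable [IsFiniteMeasure P] [IsSFiniteKernel κ]

lemma integrable_integral_of_hasCondDistrib (hW : HasCondDistrib W Z κ P)
    (hf : StronglyMeasurable f) (hint : Integrable (fun ω => f (Z ω, W ω)) P) :
    Integrable (fun ω => ∫ w, f (Z ω, w) ∂(κ (Z ω))) P := by
  have hmarginal : Integrable (fun z => ∫ w, f (z, w) ∂(κ z)) (P.map Z) :=
    Integrable.integral_compProd (κ := Kernel.const Unit (P.map Z))
      (η := Kernel.prodMkLeft Unit κ) (a := ())
      (integrable_compProd_of_hasCondDistrib hW hf hint)
  exact hmarginal.comp_aemeasurable hW.aemeasurable_fst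

lemma setIntegral_eq_setIntegral_integral_of_hasCondDistrib (hZ : Measurable Z)
    (hW : HasCondDistrib W Z κ P) (hf : StronglyMeasurable f)
    (hint : Integrable (fun ω => f (Z ω, W ω)) P) {B : Set 𝓧} (hB : MeasurableSet B) :
    ∫ ω in Z ⁻¹' B, f (Z ω, W ω) ∂P = ∫ ω in Z ⁻¹' B, ∫ w, f (Z ω, w) ∂(κ (Z ω)) ∂P := by
  calc ∫ ω in Z ⁻¹' B, f (Z ω, W ω) ∂P
      = ∫ q in B ×ˢ Set.univ, f q ∂(P.map fun ω => (Z ω, W ω)) := by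
        rw [setIntegral_map (hB.prod MeasurableSet.univ) hf.aestronglyMeasurable hW.aemeasurable,
          Set.mk_preimage_prod, Set.preimage_univ, Set.inter_univ]
    _ = ∫ z in B, ∫ w, f (z, w) ∂(κ z) ∂(P.map Z) := by
        rw [hW.map_eq, Measure.setIntegral_compProd hB MeasurableSet.univ
          (integrable_compProd_of_hasCondDistrib hW hf hint).integrableOn]
        simp only [Measure.restrict_univ]
    _ = ∫ ω in Z ⁻¹' B, ∫ w, f (Z ω, w) ∂(κ (Z ω)) ∂P :=
        setIntegral_map hB hf.integral_kernel_prod_right'.aestronglyMeasurable hZ.aemeasurable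

lemma condExp_ae_eq_integral_of_hasCondDistrib (hZ : Measurable Z) (hW : HasCondDistrib W Z κ P)
    (hf : StronglyMeasurable f) (hint : Integrable (fun ω => f (Z ω, W ω)) P)
    {m : MeasurableSpace Ω} (hm : m ≤ MeasurableSpace.comap Z inferInstance)
    (hmeas : Measurable[m] fun ω => ∫ w, f (Z ω, w) ∂(κ (Z ω))) :
    P[fun ω => f (Z ω, W ω) | m] =ᵐ[P] fun ω => ∫ w, f (Z ω, w) ∂(κ (Z ω)) := by
  have hcond := integrable_integral_of_hasCondDistrib hW hf hint
  refine (ae_eq_condExp_of_forall_setIntegral_eq (hm.trans hZ.comap_le) hint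
    (fun _ _ _ => hcond.integrableOn) (fun D hD _ => ?_) hmeas.aestronglyMeasurable).symm
  obtain ⟨B, hB, rfl⟩ := hm D hD
  exact (setIntegral_eq_setIntegral_integral_of_hasCondDistrib hZ hW hf hint hB).symm

end CondExp

lemma exists_measurable_comp_eq_of_dependsOn {ι ι' 𝓨 β : Type*} [MeasurableSpace 𝓨] [Nonempty 𝓨]
    [MeasurableSpace β] {e : ι' → ι} {Φ : (ι → 𝓨) → β} (hΦ : Measurable Φ)
    (he : DependsOn Φ (Set.range e)) :
    ∃ Ψ : (ι' → 𝓨) → β, Measurable Ψ ∧ ∀ y, Ψ (y ∘ e) = Φ y := by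
  classical
  let extension (z : ι' → 𝓨) : ι → 𝓨 := Function.extend e z fun _ => Classical.arbitrary 𝓨
  refine ⟨fun z => Φ (extension z), hΦ.comp (measurable_pi_lambda _ fun i => ?_), fun y => he ?_⟩
  · by_cases hi : ∃ j, e j = i
    · simpa [extension, Function.extend, hi] using measurable_pi_apply _
    · simp [extension, hi]
  · rintro _ ⟨j, rfl⟩
    exact Function.FactorsThrough.extend_apply (fun a b hab => congrArg y hab) _ j

end ConditionalLaw

namespace HMM

variable {X Y : Type*} [MeasurableSpace X] [MeasurableSpace Y] (M : HMM X Y)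

section Predictor

variable (χ : Measure X)

lemma measurable_lintegral_L_comp [SFinite χ] (n : ℕ) {f : (ℕ → Y) × X → ℝ≥0∞}
    (hf : Measurable f) : Measurable fun y => ∫⁻ x, f (y, x) ∂(M.L y 0 n ∘ₘ χ) := by
  induction n generalizing f with
  | zero =>
    simp only [L, Measure.id_comp]
    exact hf.lintegral_prod_right'
  | succ n ih =>
    have hlik : Measurable fun p : (ℕ → Y) × X => M.g p.2 (p.1 n) :=
      M.measurable_g.comp (by fun_prop : Measurable fun p : (ℕ → Y) × X => (p.2, p.1 n))
    have hmean : Measurable fun p : (ℕ → Y) × X => ∫⁻ x', f (p.1, x') ∂(M.Q p.2) :=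
      Measurable.lintegral_kernel_prod_right (κ := M.Q.comap Prod.snd measurable_snd)
        (f := fun p x' => f (p.1, x')) (by fun_prop)
    have hsucc (y : ℕ → Y) : ∫⁻ x, f (y, x) ∂(M.L y 0 (n + 1) ∘ₘ χ)
        = ∫⁻ x, ENNReal.ofReal (M.g x (y n)) * ∫⁻ x', f (y, x') ∂(M.Q x)
          ∂(M.L y 0 n ∘ₘ χ) := by
      rw [L_comp_succ, Measure.lintegral_bind (Kernel.aemeasurable _) (by fun_prop)]
      simp only [step_apply, lintegral_smul_measure, smul_eq_mul]
    simp_rw [hsucc]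
    exact ih (hlik.ennreal_ofReal.mul hmean)

lemma predictor_univ_le_one (n : ℕ) (y : ℕ → Y) : M.predictor χ y n Set.univ ≤ 1 :=
  ENNReal.inv_mul_le_one _

lemma measurable_predictor [SFinite χ] (n : ℕ) : Measurable fun y => M.predictor χ y n := by
  refine Measure.measurable_of_measurable_coe _ fun A hA => ?_
  have hunnorm {A : Set X} (hA : MeasurableSet A) :
      Measurable fun y : ℕ → Y => (M.L y 0 n ∘ₘ χ) A := by
    have hind : Measurable fun p : (ℕ → Y) × X => A.indicator (1 : X → ℝ≥0∞) p.2 :=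
      (measurable_one.indicator hA).comp measurable_snd
    simpa only [lintegral_indicator_one hA] using M.measurable_lintegral_L_comp χ n hind
  exact (hunnorm MeasurableSet.univ).inv.mul (hunnorm hA)

lemma measurable_integral_predictor [SFinite χ] (n : ℕ) {h : X → ℝ} (hh : Measurable h) :
    Measurable fun y => ∫ x, h x ∂(M.predictor χ y n) :=
  let κ : Kernel (ℕ → Y) X := ⟨_, M.measurable_predictor χ n⟩
  have : IsFiniteKernel κ := ⟨⟨1, ENNReal.one_lt_top, M.predictor_univ_le_one χ n⟩⟩
  (hh.stronglyMeasurable.integral_kernel (κ := κ)).measurable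

lemma dependsOn_L (n : ℕ) : DependsOn (fun y => M.L y 0 n) (Set.Iio n) := by
  induction n with
  | zero => exact fun _ _ _ => rfl
  | succ n ih =>
    intro y y' hy
    have hprev : M.L y 0 n = M.L y' 0 n := ih fun k hk => hy k (Nat.lt_succ_of_lt hk)
    have hlast : y (0 + n) = y' (0 + n) := hy (0 + n) (by simp)
    simp only [L, hprev, hlast]

lemma dependsOn_predictor (n : ℕ) : DependsOn (fun y => M.predictor χ y n) (Set.Iio n) := by
  intro y y' hy
  have hL : M.L y 0 n = M.L y' 0 n := M.dependsOn_L n hy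
  simp only [predictor, hL]

end Predictor

section ConditionalLaw

variable {Ω : Type*} [MeasurableSpace Ω] {P : Measure Ω} [IsProbabilityMeasure P]
  {Yobs : ℕ → Ω → Y} (hY : ∀ k, Measurable (Yobs k)) {χ : Measure X}
  {N : ℕ} {ξ : ℕ → Fin N → Ω → X} (hξ : M.IsBootstrapFilter χ P Yobs N ξ)

include hY hξ

lemma hasCondDistrib_particles_transition (n : ℕ) :
    HasCondDistrib (fun ω i => ξ (n + 1) i ω) (fun ω => (fun k => Yobs k ω, fun i => ξ n i ω))
      (M.transition N n) P := by
  have hpresent : Measurable (Prod.map id fun past i => past (Fin.last n) i :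
      (ℕ → Y) × (Fin (n + 1) → Fin N → X) → (ℕ → Y) × (Fin N → X)) := by fun_prop
  have hpast : Measurable fun ω => (fun k => Yobs k ω, fun (k : Fin (n + 1)) i => ξ k i ω) :=
    (measurable_pi_lambda _ hY).prodMk
      (measurable_pi_lambda _ fun k => measurable_pi_lambda _ (hξ.measurable k))
  refine HasCondDistrib.comp_right (hf := hpresent)
    (hasCondDistrib_of_condExp_box hpast (hξ.measurable (n + 1)) fun A hA => ?_)
  have hnext := hξ.next n A hA
  rw [← MeasurableSpace.comap_prodMk] at hnext
  filter_upwards [hnext] with ω hω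
  refine hω.trans ?_
  rw [Kernel.comap_apply, transition, Kernel.comap_apply, mutation_apply, measureReal_def,
    Measure.pi_pi, ENNReal.toReal_prod]
  rfl

variable [IsFiniteMeasure χ]

lemma hasCondDistrib_particles_zero :
    HasCondDistrib (fun ω i => ξ 0 i ω) (fun ω k => Yobs k ω) (M.particleKernel χ N 0) P := by
  refine hasCondDistrib_of_condExp_box (measurable_pi_lambda _ hY) (hξ.measurable 0) fun A hA => ?_
  filter_upwards [hξ.init A hA] with ω hω
  rw [hω, particleKernel, Kernel.const_apply, measureReal_def, Measure.pi_pi, ENNReal.toReal_prod]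
  rfl

theorem hasCondDistrib_particles (n : ℕ) :
    HasCondDistrib (fun ω i => ξ n i ω) (fun ω k => Yobs k ω) (M.particleKernel χ N n) P := by
  induction n with
  | zero => exact M.hasCondDistrib_particles_zero hY hξ
  | succ n ih =>
    exact (hasCondDistrib_prodMk ih (M.hasCondDistrib_particles_transition hY hξ n)).snd

theorem condExp_obs_particles_ae_eq (n : ℕ) {F : (ℕ → Y) × (Fin N → X) → ℝ} (hF : BddMeas F)
    (hdep : DependsOn (fun y x => F (y, x)) (Set.Iio n)) :
    P[fun ω => F (fun k => Yobs k ω, fun i => ξ n i ω) |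
        MeasurableSpace.comap (fun ω (k : Fin n) => Yobs k ω) inferInstance]
      =ᵐ[P] fun ω => ∫ x, F (fun k => Yobs k ω, x)
        ∂(M.particleKernel χ N n fun k => Yobs k ω) := by
  have hYm : Measurable fun ω k => Yobs k ω := measurable_pi_lambda _ hY
  have hξm : Measurable fun ω i => ξ n i ω := measurable_pi_lambda _ (hξ.measurable n)
  have hFm : StronglyMeasurable F := hF.measurable.stronglyMeasurable
  have : Nonempty Y := (nonempty_of_isProbabilityMeasure P).map (Yobs 0)
  have hmean : DependsOn (fun y => ∫ x, F (y, x) ∂(M.particleKernel χ N n y))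
      (Set.range (Fin.val : Fin n → ℕ)) := by
    rw [Fin.range_val]
    intro y y' hy
    have hker : M.particleKernel χ N n y = M.particleKernel χ N n y' :=
      M.dependsOn_particleKernel χ N n hy
    have hFy : (fun x => F (y, x)) = fun x => F (y', x) := hdep hy
    simp only [hker, hFy]
  obtain ⟨Ψ, hΨ, hΨ_comp⟩ := exists_measurable_comp_eq_of_dependsOn
    hFm.integral_kernel_prod_right'.measurable hmean
  refine condExp_ae_eq_integral_of_hasCondDistrib hYm (M.hasCondDistrib_particles hY hξ n) hFm
    ((hF.integrable (P.map _)).comp_measurable (hYm.prodMk hξm)) ?_ ?_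
  · have hrestrict : Measurable fun (y : ℕ → Y) (k : Fin n) => y k := by fun_prop
    rintro _ ⟨B, hB, rfl⟩
    exact ⟨_, hrestrict hB, rfl⟩
  · simp_rw [← hΨ_comp]
    exact hΨ.comp (comap_measurable _)

end ConditionalLaw

end HMM

lemma abs_empMean_le {X : Type*} {h : X → ℝ} {C : ℝ} (hC : ∀ x, |h x| ≤ C) {N : ℕ} [NeZero N]
    (x : Fin N → X) : |empMean h x| ≤ C := by
  have hN : (0 : ℝ) < N := by exact_mod_cast NeZero.pos N
  rw [empMean, abs_div, Nat.abs_cast, div_le_iff₀ hN]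
  calc |∑ i, h (x i)| ≤ ∑ i, |h (x i)| := Finset.abs_sum_le_sum_abs _ _
    _ ≤ ∑ _i : Fin N, C := Finset.sum_le_sum fun i _ => hC (x i)
    _ = C * N := by simp [mul_comm]

namespace HMM

variable {X Y : Type*} [MeasurableSpace X] [MeasurableSpace Y] (M : HMM X Y)

lemma abs_integral_predictor_le (χ : Measure X) (n : ℕ) (y : ℕ → Y) {h : X → ℝ} {C : ℝ}
    (hC0 : 0 ≤ C) (hC : ∀ x, |h x| ≤ C) : |∫ x, h x ∂(M.predictor χ y n)| ≤ C := by
  have hmass := M.predictor_univ_le_one χ n y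
  have : IsFiniteMeasure (M.predictor χ y n) := ⟨hmass.trans_lt ENNReal.one_lt_top⟩
  calc |∫ x, h x ∂(M.predictor χ y n)| ≤ C * (M.predictor χ y n).real Set.univ :=
        norm_integral_le_of_norm_le_const (f := h) (ae_of_all _ hC)
    _ ≤ C := mul_le_of_le_one_right hC0
        (ENNReal.toReal_mono ENNReal.one_ne_top hmass |>.trans_eq ENNReal.toReal_one)

lemma bddMeas_abs_empMean_sub_predictor_rpow (χ : Measure X) [SFinite χ] (n N : ℕ) [NeZero N]
    {h : X → ℝ} (hh : BddMeas h) {p : ℝ} (hp : 0 ≤ p) :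
    BddMeas fun q : (ℕ → Y) × (Fin N → X) =>
      |empMean h q.2 - ∫ x, h x ∂(M.predictor χ q.1 n)| ^ p := by
  obtain ⟨C, hC0, hC⟩ := hh.exists_bound
  have hmeas := hh.measurable
  have hmean : Measurable fun q : (ℕ → Y) × (Fin N → X) => empMean h q.2 := by
    unfold empMean
    fun_prop
  have hpred : Measurable fun q : (ℕ → Y) × (Fin N → X) => ∫ x, h x ∂(M.predictor χ q.1 n) :=
    (M.measurable_integral_predictor χ n hmeas).comp measurable_fst
  refine ⟨(hmean.sub hpred).abs.pow_const p, (C + C) ^ p, fun q => ?_⟩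
  rw [abs_of_nonneg (Real.rpow_nonneg (abs_nonneg _) p)]
  have herror := (abs_sub _ _).trans
    (add_le_add (abs_empMean_le hC q.2) (M.abs_integral_predictor_le χ n q.1 hC0 hC))
  gcongr

end HMM

lemma IsStationarySeq.map_eq {Ω Y : Type*} [MeasurableSpace Ω] [MeasurableSpace Y] {P : Measure Ω}
    {Yobs : ℕ → Ω → Y} (hstat : IsStationarySeq P Yobs) (hY : ∀ k, Measurable (Yobs k)) (k : ℕ) :
    P.map (Yobs k) = P.map (Yobs 0) := by
  induction k with
  | zero => rfl
  | succ k ih =>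
    have hshift := congrArg (Measure.map fun y : ℕ → Y => y k) hstat
    rw [Measure.map_map (by fun_prop) (measurable_pi_lambda _ fun k => hY (k + 1)),
      Measure.map_map (by fun_prop) (measurable_pi_lambda _ hY)] at hshift
    exact hshift.trans ih

lemma HMM.LikelihoodCondition.ae_bounded {X Y Ω : Type*} [MeasurableSpace X] [MeasurableSpace Y]
    [MeasurableSpace Ω] {M : HMM X Y} {P : Measure Ω} {Yobs : ℕ → Ω → Y}
    (hM : M.LikelihoodCondition P Yobs) (hY : ∀ k, Measurable (Yobs k))
    (hstat : IsStationarySeq P Yobs) :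
    ∀ᵐ ω ∂P, ∀ k, ∃ B, ∀ x, M.g x (Yobs k ω) ≤ B := by
  have hlog : AEMeasurable (fun y => (ENNReal.log (M.likSup y)).toENNReal) (P.map (Yobs 0)) :=
    measurable_ereal_toENNReal.comp_aemeasurable
      (ENNReal.measurable_log.comp_aemeasurable hM.aemeasurable_likSup)
  have hfinite : ∀ᵐ y ∂(P.map (Yobs 0)), M.likSup y < ∞ := by
    have hint := hM.integrable_log
    rw [← lintegral_map' hlog (hY 0).aemeasurable] at hint
    filter_upwards [ae_lt_top' hlog hint.ne] with y hy
    refine lt_top_iff_ne_top.2 fun htop => ?_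
    simp [htop] at hy
  refine ae_all_iff.2 fun k => ?_
  rw [← hstat.map_eq hY k] at hfinite
  filter_upwards [ae_of_ae_map (hY k).aemeasurable hfinite] with ω hω
  refine ⟨(M.likSup (Yobs k ω)).toReal, fun x => ?_⟩
  rw [← ENNReal.ofReal_le_iff_le_toReal hω.ne]
  exact le_iSup (fun x => ENNReal.ofReal (M.g x (Yobs k ω))) x

theorem mainTheorem3_general {X Y Ω : Type*} [MeasurableSpace X] [MeasurableSpace Y]
    [MeasurableSpace Ω] (M : HMM X Y) (hg : ∀ x y, 0 < M.g x y)
    (P : Measure Ω) [IsProbabilityMeasure P] (Yobs : ℕ → Ω → Y) (hY : ∀ k, Measurable (Yobs k))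
    (hb : ∀ᵐ ω ∂P, ∀ k, ∃ B, ∀ x, M.g x (Yobs k ω) ≤ B)
    (h : X → ℝ) (hmeas : Measurable h) (hbdd : ∃ C, ∀ x, |h x| ≤ C)
    (p : ℝ) (hp : 0 < p) (χ : Measure X) [IsProbabilityMeasure χ]
    (ξ : (N : ℕ) → ℕ → Fin N → Ω → X)
    (hξ : ∀ N, 1 ≤ N → M.IsBootstrapFilter χ P Yobs N (ξ N)) (n : ℕ) :
    ∀ᵐ ω ∂P,
      Tendsto
        (fun N : ℕ => √(N : ℝ) *
          ((P[fun ω' => |empMean h (fun i => ξ N n i ω')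
                - ∫ x, h x ∂(M.predictor χ (fun k => Yobs k ω') n)| ^ p |
              MeasurableSpace.comap (fun ω' (k : Fin n) => Yobs k ω') inferInstance]) ω)
            ^ (1 / p))
        atTop
        (𝓝 (√2 * M.asympStd χ (fun k => Yobs k ω) n h *
          (Real.Gamma ((p + 1) / 2) / √Real.pi) ^ (1 / p))) ∧
      √2 * M.asympStd χ (fun k => Yobs k ω) n h *
          (Real.Gamma ((p + 1) / 2) / √Real.pi) ^ (1 / p) =
        (∫ z, |M.asympStd χ (fun k => Yobs k ω) n h * z| ^ p ∂(gaussianReal 0 1)) ^ (1 / p) := by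
  have hh : BddMeas h := ⟨hmeas, hbdd⟩
  have hcond (N : ℕ) := M.condExp_obs_particles_ae_eq hY (hξ (N + 1) (Nat.le_add_left 1 N)) n
    (M.bddMeas_abs_empMean_sub_predictor_rpow χ n (N + 1) hh hp.le) fun y y' hy => by
      have hpred : M.predictor χ y n = M.predictor χ y' n := M.dependsOn_predictor χ n hy
      simp only [hpred]
  filter_upwards [hb, ae_all_iff.2 hcond] with ω hbω hω
  refine ⟨?_, (integral_abs_mul_rpow_gaussianReal (Real.sqrt_nonneg _) hp).symm⟩
  rw [← tendsto_add_atTop_iff_nat 1]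
  refine (M.tendsto_sqrt_mul_integral_rpow hbω hg χ n hh hp).congr fun N => ?_
  rw [hω N]

end

theorem mainTheorem3 {X Y Ω : Type*} [MeasurableSpace X] [MeasurableSpace Y] [MeasurableSpace Ω]
    (M : HMM X Y) (P : Measure Ω) [IsProbabilityMeasure P]
    (Yobs : ℕ → Ω → Y) (hY : ∀ k, Measurable (Yobs k)) (hstat : IsStationarySeq P Yobs)
    (hM : M.LikelihoodCondition P Yobs)
    (h : X → ℝ) (hmeas : Measurable h) (hbdd : ∃ C, ∀ x, |h x| ≤ C)
    (p : ℝ) (hp : 0 < p)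
    (χ : Measure X) [IsProbabilityMeasure χ]
    (ξ : (N : ℕ) → ℕ → Fin N → Ω → X)
    (hξ : ∀ N, 1 ≤ N → M.IsBootstrapFilter χ P Yobs N (ξ N))
    (n : ℕ) :
    ∀ᵐ ω ∂P,
      Tendsto
        (fun N : ℕ => √(N : ℝ) *
          ((P[fun ω' => |empMean h (fun i => ξ N n i ω')
                - ∫ x, h x ∂(M.predictor χ (fun k => Yobs k ω') n)| ^ p |
              MeasurableSpace.comap (fun ω' (k : Fin n) => Yobs k ω') inferInstance]) ω)
            ^ (1 / p))
        atTop
        (𝓝 (√2 * M.asympStd χ (fun k => Yobs k ω) n h *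
          (Real.Gamma ((p + 1) / 2) / √Real.pi) ^ (1 / p))) ∧
      √2 * M.asympStd χ (fun k => Yobs k ω) n h *
          (Real.Gamma ((p + 1) / 2) / √Real.pi) ^ (1 / p) =
        (∫ z, |M.asympStd χ (fun k => Yobs k ω) n h * z| ^ p ∂(gaussianReal 0 1)) ^ (1 / p) :=
  mainTheorem3_general M hM.g_pos P Yobs hY (hM.ae_bounded hY hstat) h hmeas hbdd p hp χ ξ hξ n
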